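/- Let $\Bbbk$ be a field, $n\ge 1$, and $\alpha,q\in\Bbbk^*=\Bbbk\setminus\{0\}$ with $q^2\neq 1$. Let $\mathscr A_{\alpha,q}$ be the associative unital $\Bbbk$-algebra generated by $e_1,e_2,e_3$ subject to $$e_1e_3=q^{-1}e_3e_1,\quad e_2e_3=qe_3e_2+\alpha,\quad e_2e_1=q^{-1}e_1e_2-q^{-1}e_3,\quad e_3^2+(q^2-1)e_3e_1e_2+\alpha q(q+1)e_1=0 .$$ For a commutative $\Bbbk$-algebra $R$, a $\Bbbk$-algebra automorphism $\sigma$ of $R$ and $a\in R$, the generalized Weyl algebra $R(\sigma,a)$ is the $\Bbbk$-algebra generated over $R$ by $x,y$ subject to $xy=\sigma(a)$, $yx=a$, $xr=\sigma(r)x$, $yr=\sigma^{-1}(r)y$ for all $r\in R$. Let $A(1,q):=\Bbbk[h^{\pm1}](\sigma,h-1)$ with $\sigma(h)=qh$, and let $A:=A(1,q)^{\otimes n}$ (tensor product over $\Bbbk$). Write $h_i,x_i,y_i$ for the copies of $h,x,y$ in the $i$-th factor of $A$, and let $\sigma_i$ be the automorphism of $\Bbbk[h_1^{\pm1},\dots,h_n^{\pm1}]$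 with $\sigma_i(h_i)=qh_i$ and $\sigma_i(h_j)=h_j$ for $j\ne i$. A $\Bbbk$-algebra automorphism of $A$ is called qwa-tame if it belongs to the subgroup of $\mathrm{Aut}(A)$ generated by all automorphisms of the following three kinds: * $\phi_g=g\otimes 1\otimes\cdots\otimes 1$, where $g\in\mathrm{Aut}(A(1,q))$; * $\chi_w$, where $w$ is a permutation of $\{1,\dots,n\}$: $\chi_w(h_i)=h_{w(i)}$, $\chi_w(x_i)=x_{w(i)}$, $\chi_w(y_i)=y_{w(i)}$ for all $i$; * $\xi_{u}$, where $u=(u_1,\dots,u_n)$ is a vector of units of $A$ lying in $\Bbbk[h_1^{\pm1},\dots,h_n^{\pm1}]$ such that $u_i\sigma_i(u_l)=u_l\sigma_l(u_i)$ for all $i\neq l$: $\xi_u(h_i)=h_i$, $\xi_u(x_i)=u_ix_i$, $\xi_u(y_i)=y_iu_i^{-1}$ for all $i$. **Theorem.** The $\Bbbk$-algebras $\mathscr A_{\alpha,q}$ and $A(1,q)$ are isomorphic, and every $\Bbbk$-algebra automorphism of the $n$-fold tensor power $\mathscr A_{\alpha,q}\otimes\cdots\otimes\mathscr A_{\alpha,q}$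 is qwa-tame. That is, for every isomorphism $\theta:\mathscr A_{\alpha,q}\to A(1,q)$ and every automorphism $\psi$ of $\mathscr A_{\alpha,q}^{\otimes n}$, the automorphism $\theta^{\otimes n}\,\psi\,(\theta^{\otimes n})^{-1}$ of $A$ is qwa-tame. -/

import Mathlib

open scoped TensorProduct

noncomputable section

namespace QWeyl

/-! ### The algebras `𝒜_{α,q}` -/

/-- The defining relations of `𝒜_{α,q}` in the free algebra on `e₁, e₂, e₃`
(the generators are indexed by `0, 1, 2`). -/
inductive ARel (k : Type*) [Field k] (α q : kˣ) :
    FreeAlgebra k (Fin 3) → FreeAlgebra k (Fin 3) → Prop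
  | rel13 : ARel k α q
      (FreeAlgebra.ι k 0 * FreeAlgebra.ι k 2)
      ((q : k)⁻¹ • (FreeAlgebra.ι k 2 * FreeAlgebra.ι k 0))
  | rel23 : ARel k α q
      (FreeAlgebra.ι k 1 * FreeAlgebra.ι k 2)
      ((q : k) • (FreeAlgebra.ι k 2 * FreeAlgebra.ι k 1) + algebraMap k _ (α : k))
  | rel21 : ARel k α q
      (FreeAlgebra.ι k 1 * FreeAlgebra.ι k 0)
      ((q : k)⁻¹ • (FreeAlgebra.ι k 0 * FreeAlgebra.ι k 1) - (q : k)⁻¹ • FreeAlgebra.ι k 2)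
  | rel33 : ARel k α q
      (FreeAlgebra.ι k 2 ^ 2
        + ((q : k) ^ 2 - 1) • (FreeAlgebra.ι k 2 * FreeAlgebra.ι k 0 * FreeAlgebra.ι k 1)
        + ((α : k) * (q : k) * ((q : k) + 1)) • FreeAlgebra.ι k 0)
      0

/-- The algebra `𝒜_{α,q}`. -/
def AAlg (k : Type*) [Field k] (α q : kˣ) : Type _ := RingQuot (ARel k α q)

instance (k : Type*) [Field k] (α q : kˣ) : Ring (AAlg k α q) :=
  inferInstanceAs (Ring (RingQuot (ARel k α q)))

instance (k : Type*) [Field k] (α q : kˣ) : Algebra k (AAlg k α q) :=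
  inferInstanceAs (Algebra k (RingQuot (ARel k α q)))

/-! ### Generalized Weyl algebras of degree one -/

/-- Generators of `R(σ, a)`: the elements of `R` and the two indeterminates `x`, `y`. -/
inductive GWAGen (R : Type*)
  | coe (r : R)
  | x
  | y

/-- The relations of the generalized Weyl algebra `R(σ, a)`. The first three make `R` map to
the quotient by a homomorphism of `k`-algebras. -/
inductive GWARel {k R : Type*} [Field k] [CommRing R] [Algebra k R] (σ : R ≃ₐ[k] R) (a : R) :
    FreeAlgebra k (GWAGen R) → FreeAlgebra k (GWAGen R) → Prop
  | coe_add (r s : R) : GWARel σ a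
      (FreeAlgebra.ι k (.coe (r + s)))
      (FreeAlgebra.ι k (.coe r) + FreeAlgebra.ι k (.coe s))
  | coe_mul (r s : R) : GWARel σ a
      (FreeAlgebra.ι k (.coe (r * s)))
      (FreeAlgebra.ι k (.coe r) * FreeAlgebra.ι k (.coe s))
  | coe_algebraMap (c : k) : GWARel σ a
      (FreeAlgebra.ι k (.coe (algebraMap k R c)))
      (algebraMap k _ c)
  | x_mul_y : GWARel σ a
      (FreeAlgebra.ι k .x * FreeAlgebra.ι k .y) (FreeAlgebra.ι k (.coe (σ a)))
  | y_mul_x : GWARel σ a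
      (FreeAlgebra.ι k .y * FreeAlgebra.ι k .x) (FreeAlgebra.ι k (.coe a))
  | x_mul_coe (r : R) : GWARel σ a
      (FreeAlgebra.ι k .x * FreeAlgebra.ι k (.coe r))
      (FreeAlgebra.ι k (.coe (σ r)) * FreeAlgebra.ι k .x)
  | y_mul_coe (r : R) : GWARel σ a
      (FreeAlgebra.ι k .y * FreeAlgebra.ι k (.coe r))
      (FreeAlgebra.ι k (.coe (σ.symm r)) * FreeAlgebra.ι k .y)

/-- The generalized Weyl algebra `R(σ, a)` of degree one over a commutative `k`-algebra `R`. -/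
def GWA {k R : Type*} [Field k] [CommRing R] [Algebra k R] (σ : R ≃ₐ[k] R) (a : R) : Type _ :=
  RingQuot (GWARel σ a)

namespace GWA

variable {k R : Type*} [Field k] [CommRing R] [Algebra k R] (σ : R ≃ₐ[k] R) (a : R)

instance : Ring (GWA σ a) := inferInstanceAs (Ring (RingQuot (GWARel σ a)))

instance : Algebra k (GWA σ a) := inferInstanceAs (Algebra k (RingQuot (GWARel σ a)))

/-- The class of a generator in `R(σ, a)`. -/
def gen (g : GWAGen R) : GWA σ a := RingQuot.mkAlgHom k (GWARel σ a) (FreeAlgebra.ι k g)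

/-- The image of `r : R` in `R(σ, a)`. -/
def coe (r : R) : GWA σ a := gen σ a (.coe r)

/-- The indeterminate `x`. -/
def x : GWA σ a := gen σ a .x

/-- The indeterminate `y`. -/
def y : GWA σ a := gen σ a .y

theorem coe_mul (r s : R) : coe σ a (r * s) = coe σ a r * coe σ a s := by
  refine (RingQuot.mkAlgHom_rel k (GWARel.coe_mul (σ := σ) (a := a) r s)).trans ?_
  rw [map_mul]
  rfl

theorem coe_one : coe σ a 1 = 1 := by
  have h1 := RingQuot.mkAlgHom_rel k (GWARel.coe_algebraMap (σ := σ) (a := a) 1)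
  rw [map_one, map_one, map_one] at h1
  exact h1

end GWA

/-! ### Rescaling automorphisms of (Laurent polynomial) group algebras -/

section Twist

variable {k G : Type*} [Field k] [AddCommGroup G]

/-- For a character `χ` of `G`, the endomorphism `T^m ↦ χ(m) T^m` of the group algebra. -/
def twistHom (χ : Multiplicative G →* kˣ) : AddMonoidAlgebra k G →ₐ[k] AddMonoidAlgebra k G :=
  AddMonoidAlgebra.lift k (AddMonoidAlgebra k G) G
    { toFun := fun m => AddMonoidAlgebra.single m.toAdd (χ m : k)
      map_one' := by simp [AddMonoidAlgebra.one_def]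
      map_mul' := fun m m' => by simp [AddMonoidAlgebra.single_mul_single] }

theorem twistHom_single (χ : Multiplicative G →* kˣ) (m : G) (c : k) :
    twistHom χ (AddMonoidAlgebra.single m c)
      = AddMonoidAlgebra.single m (c * (χ (Multiplicative.ofAdd m) : k)) := by
  simp [twistHom, AddMonoidAlgebra.lift_single]

theorem twistHom_comp (χ χ' : Multiplicative G →* kˣ) (h : ∀ m, χ m * χ' m = 1) :
    (twistHom χ).comp (twistHom χ') = AlgHom.id k (AddMonoidAlgebra k G) := by
  refine AlgHom.ext fun p => ?_
  induction p using AddMonoidAlgebra.induction_linear with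
  | zero => simp
  | add p p' hp hp' => rw [map_add, hp, hp', map_add]
  | single m c =>
    have h1 : (χ' (Multiplicative.ofAdd m) : k) * (χ (Multiplicative.ofAdd m) : k) = 1 := by
      rw [← Units.val_mul, mul_comm, h, Units.val_one]
    rw [AlgHom.comp_apply, twistHom_single, twistHom_single, mul_assoc, h1, mul_one]
    rfl

/-- The automorphism `T^m ↦ χ(m) T^m` of the group algebra of `G`. -/
def twist (χ : Multiplicative G →* kˣ) : AddMonoidAlgebra k G ≃ₐ[k] AddMonoidAlgebra k G :=
  AlgEquiv.ofAlgHom (twistHom χ) (twistHom χ⁻¹)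
    (twistHom_comp _ _ (by simp)) (twistHom_comp _ _ (by simp))

end Twist

/-! ### The algebras `A(d, q)` and their tensor powers -/

section Qwa

variable (k : Type*) [Field k]

/-- The automorphism `σ` of `k[h, h⁻¹]` with `σ(h) = q h`. -/
def sigma₁ (q : kˣ) : LaurentPolynomial k ≃ₐ[k] LaurentPolynomial k := twist (zpowersHom kˣ q)

/-- `A(d, q) = k[h, h⁻¹](σ, h^d - 1)` with `σ(h) = q h`. -/
abbrev A₁ (d : ℕ) (q : kˣ) : Type _ :=
  GWA (sigma₁ k q) ((LaurentPolynomial.T 1) ^ d - 1)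

/-- The tensor power `A(n, d, (q, …, q)) = A(d, q) ⊗ ⋯ ⊗ A(d, q)` with `n` factors. -/
abbrev A (n d : ℕ) (q : kˣ) : Type _ := ⨂[k] _ : Fin n, A₁ k d q

variable {k} (n d : ℕ) (q : kˣ)

/-- The generator `h_i`. -/
def h (i : Fin n) : A k n d q :=
  PiTensorProduct.singleAlgHom (R := k) (A := fun _ : Fin n => A₁ k d q) i
    (GWA.coe _ _ (LaurentPolynomial.T 1))

/-- The generator `x_i`. -/
def x (i : Fin n) : A k n d q :=
  PiTensorProduct.singleAlgHom (R := k) (A := fun _ : Fin n => A₁ k d q) i (GWA.x _ _)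

/-- The generator `y_i`. -/
def y (i : Fin n) : A k n d q :=
  PiTensorProduct.singleAlgHom (R := k) (A := fun _ : Fin n => A₁ k d q) i (GWA.y _ _)

/-- The Laurent polynomial ring `k[h_1^{±1}, …, h_n^{±1}]`, as the group algebra of `ℤⁿ`. -/
abbrev Laurent (k : Type*) [Field k] (n : ℕ) : Type _ := AddMonoidAlgebra k (Fin n → ℤ)

/-- The automorphism `σ_i` of `k[h_1^{±1}, …, h_n^{±1}]` with `σ_i(h_i) = q h_i` and
`σ_i(h_j) = h_j` for `j ≠ i`. -/
def sigma (i : Fin n) : Laurent k n ≃ₐ[k] Laurent k n :=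
  twist ((zpowersHom kˣ q).comp (AddMonoidHom.toMultiplicative (Pi.evalAddMonoidHom _ i)))

/-- The natural map `k[h_1^{±1}, …, h_n^{±1}] → A(n, d, (q, …, q))`; it sends the monomial
`h_1^{m_1} ⋯ h_n^{m_n}` to `h^{m_1} ⊗ ⋯ ⊗ h^{m_n}`. -/
def ofLaurent : Laurent k n →ₐ[k] A k n d q :=
  AddMonoidAlgebra.lift k (A k n d q) (Fin n → ℤ)
    { toFun := fun m => PiTensorProduct.tprod k
        fun i => GWA.coe (sigma₁ k q) _ (LaurentPolynomial.T (m.toAdd i))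
      map_one' := by
        simp only [toAdd_one, Pi.zero_apply, LaurentPolynomial.T_zero, GWA.coe_one]
        rfl
      map_mul' := fun m m' => by
        rw [PiTensorProduct.tprod_mul_tprod]
        congr 1
        funext i
        rw [toAdd_mul, Pi.add_apply, LaurentPolynomial.T_add, GWA.coe_mul]
        rfl }

end Qwa

/-! ### Tensor products of algebra isomorphisms -/

/-- The isomorphism `f_1 ⊗ ⋯ ⊗ f_n` of tensor products of algebras. -/
def tensorCongr {k ι : Type*} [Field k] {B C : ι → Type*} [∀ i, Ring (B i)] [∀ i, Algebra k (B i)]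
    [∀ i, Ring (C i)] [∀ i, Algebra k (C i)] (f : ∀ i, B i ≃ₐ[k] C i) :
    (⨂[k] i, B i) ≃ₐ[k] (⨂[k] i, C i) :=
  AlgEquiv.ofLinearEquiv (PiTensorProduct.congr fun i => (f i).toLinearEquiv)
    (by
      rw [PiTensorProduct.one_def, PiTensorProduct.congr_tprod, PiTensorProduct.one_def]
      congr 1
      funext i
      simp)
    (by
      refine (LinearMap.map_mul_iff
        (PiTensorProduct.congr fun i => (f i).toLinearEquiv).toLinearMap).2 ?_
      ext b b'
      change PiTensorProduct.congr (fun i => (f i).toLinearEquiv) (PiTensorProduct.tprod k b * PiTensorProduct.tprod k b')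
        = PiTensorProduct.congr (fun i => (f i).toLinearEquiv) (PiTensorProduct.tprod k b)
          * PiTensorProduct.congr (fun i => (f i).toLinearEquiv) (PiTensorProduct.tprod k b')
      rw [PiTensorProduct.tprod_mul_tprod, PiTensorProduct.congr_tprod,
        PiTensorProduct.congr_tprod, PiTensorProduct.congr_tprod, PiTensorProduct.tprod_mul_tprod]
      congr 1
      funext i
      exact map_mul (f i) (b i) (b' i))

/-! ### qwa-tame automorphisms -/

section Tame

variable {k : Type*} [Field k] (n d : ℕ) (q : kˣ)

/-- The automorphism `φ_g = g ⊗ 1 ⊗ ⋯ ⊗ 1`. -/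
def phi [NeZero n] (g : A₁ k d q ≃ₐ[k] A₁ k d q) : A k n d q ≃ₐ[k] A k n d q :=
  tensorCongr fun i : Fin n => if i = 0 then g else AlgEquiv.refl

/-- `f` is the automorphism `χ_w` which permutes the tensor factors. -/
def IsChi (w : Equiv.Perm (Fin n)) (f : A k n d q ≃ₐ[k] A k n d q) : Prop :=
  ∀ i, f (h n d q i) = h n d q (w i) ∧ f (x n d q i) = x n d q (w i) ∧
    f (y n d q i) = y n d q (w i)

/-- `u` is a vector of units of `A(n, d, (q, …, q))` lying in `k[h_1^{±1}, …, h_n^{±1}]`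
(where `u_i` is the image of `p_i`), with `u_i σ_i(u_l) = u_l σ_l(u_i)` for `l ≠ i`. -/
def IsCompatible (u : Fin n → (A k n d q)ˣ) : Prop :=
  ∃ p : Fin n → Laurent k n, (∀ i, ofLaurent n d q (p i) = u i) ∧
    ∀ i l, l ≠ i → p i * sigma n q i (p l) = p l * sigma n q l (p i)

/-- `f` is the automorphism `ξ_u` attached to a vector of units `u`. -/
def IsXi (u : Fin n → (A k n d q)ˣ) (f : A k n d q ≃ₐ[k] A k n d q) : Prop :=
  ∀ i, f (h n d q i) = h n d q i ∧ f (x n d q i) = u i * x n d q i ∧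
    f (y n d q i) = y n d q i * ((u i)⁻¹ : (A k n d q)ˣ)

/-- The group of qwa-tame automorphisms of `A(n, d, (q, …, q))`. -/
def qwaTame [NeZero n] : Subgroup (A k n d q ≃ₐ[k] A k n d q) :=
  Subgroup.closure
    (Set.range (phi n d q) ∪ {f | ∃ w, IsChi n d q w f} ∪
      {f | ∃ u, IsCompatible n d q u ∧ IsXi n d q u f})

end Tame

end QWeyl

end

/-! The isomorphism sends `x` to `e₂` and `y` to a multiple of `e₃`; then `h = 1 + yx` is forced,
and `e₁` becomes a multiple of `h⁻¹y²`. Once `𝒜_{α,q}` is identified with `A(1, q)`, it remains to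
show that every automorphism `ψ` of `A` is tame.

The algebra `A` embeds in a quantum torus, the skew group algebra of `ℤⁿ` over the Laurent ring
(`toTorus_injective`), with `x_i ↦ t_i` and `y_i ↦ (h_i - 1)`-multiple of `t_i⁻¹`. Since `ℤⁿ` has
two unique products, the factors of a nonzero homogeneous element are homogeneous
(`homogeneous_of_mul`). An element of `A` of negative degree in direction `j` is right divisible by
`y_j`, whose coefficient `h_j - 1` is not a unit (`nonneg_of_isUnit`). Hence the units of `A` are
the Laurent monomials (`isUnit_iff`), and each `x_i` is irreducible.

The Laurent ring is spanned by units, so `ψ` preserves it. As `x_i y_i` is a Laurent polynomial,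
`ψ(x_i)` is homogeneous; its degree is nonzero, so some `x_j` or `y_j` splits off, and
irreducibility makes the cofactor a unit (`aut_x`). Applying `ψ` to `y_i x_i = h_i - 1` and
comparing two-term Laurent polynomials leaves two candidates for `ψ(h_i)`, and the `q`-commutation
with `ψ(x_i)` selects one of them because `q⁻¹ ≠ q` (`aut_generators`). So `ψ(h_i)` is `h_j` or
`q⁻¹h_j⁻¹`. Flips in single factors remove the second case, a permutation of the factors makes every
`h_i` fixed, and what remains is some `ξ_u` (`mem_of_fix_h`). -/

set_option linter.unusedSimpArgs false

noncomputable section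

namespace QWeyl

/-! ### The universal property of generalized Weyl algebras -/

namespace GWA

variable {k R B : Type*} [Field k] [CommRing R] [Algebra k R] (σ : R ≃ₐ[k] R) (a : R)
  [Ring B] [Algebra k B]

theorem x_mul_coe (r : R) : x σ a * coe σ a r = coe σ a (σ r) * x σ a := by
  have h1 := RingQuot.mkAlgHom_rel k (GWARel.x_mul_coe (σ := σ) (a := a) r)
  rwa [map_mul, map_mul] at h1

theorem y_mul_coe (r : R) : y σ a * coe σ a r = coe σ a (σ.symm r) * y σ a := by
  have h1 := RingQuot.mkAlgHom_rel k (GWARel.y_mul_coe (σ := σ) (a := a) r)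
  rwa [map_mul, map_mul] at h1

theorem x_mul_y : x σ a * y σ a = coe σ a (σ a) := by
  have h1 := RingQuot.mkAlgHom_rel k (GWARel.x_mul_y (σ := σ) (a := a))
  rwa [map_mul] at h1

theorem y_mul_x : y σ a * x σ a = coe σ a a := by
  have h1 := RingQuot.mkAlgHom_rel k (GWARel.y_mul_x (σ := σ) (a := a))
  rwa [map_mul] at h1

/-- The structure map `R → R(σ, a)` as a homomorphism of algebras. -/
def coeHom : R →ₐ[k] GWA σ a where
  toFun := coe σ a
  map_one' := coe_one σ a
  map_mul' := coe_mul σ a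
  map_zero' := by
    have h1 := RingQuot.mkAlgHom_rel k (GWARel.coe_algebraMap (σ := σ) (a := a) 0)
    rwa [map_zero, map_zero, map_zero] at h1
  map_add' r s := by
    have h1 := RingQuot.mkAlgHom_rel k (GWARel.coe_add (σ := σ) (a := a) r s)
    rwa [map_add] at h1
  commutes' c := by
    have h1 := RingQuot.mkAlgHom_rel k (GWARel.coe_algebraMap (σ := σ) (a := a) c)
    rwa [AlgHom.commutes] at h1

theorem coeHom_apply (r : R) : coeHom σ a r = coe σ a r := rfl

/-- The values on generators of a homomorphism out of `R(σ, a)`. -/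
def genMap (f : R → B) (X Y : B) : GWAGen R → B
  | .coe r => f r
  | .x => X
  | .y => Y

/-- The universal property of `R(σ, a)`. -/
def lift (f : R →ₐ[k] B) (X Y : B) (hXY : X * Y = f (σ a)) (hYX : Y * X = f a)
    (hX : ∀ r, X * f r = f (σ r) * X) (hY : ∀ r, Y * f r = f (σ.symm r) * Y) :
    GWA σ a →ₐ[k] B :=
  RingQuot.liftAlgHom k ⟨FreeAlgebra.lift k (genMap f X Y), by
    intro p p' hp
    cases hp with
    | coe_add r s => simp [genMap]
    | coe_mul r s => simp [genMap]
    | coe_algebraMap c => simp [genMap]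
    | x_mul_y => simpa [genMap] using hXY
    | y_mul_x => simpa [genMap] using hYX
    | x_mul_coe r => simpa [genMap] using hX r
    | y_mul_coe r => simpa [genMap] using hY r⟩

section

variable (f : R →ₐ[k] B) (X Y : B) (hXY : X * Y = f (σ a)) (hYX : Y * X = f a)
    (hX : ∀ r, X * f r = f (σ r) * X) (hY : ∀ r, Y * f r = f (σ.symm r) * Y)

theorem lift_gen (g : GWAGen R) : lift σ a f X Y hXY hYX hX hY (gen σ a g) = genMap f X Y g := by
  refine (RingQuot.liftAlgHom_mkAlgHom_apply k _ _ _).trans ?_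
  rw [FreeAlgebra.lift_ι_apply]

theorem lift_coe (r : R) : lift σ a f X Y hXY hYX hX hY (coe σ a r) = f r := lift_gen ..

theorem lift_x : lift σ a f X Y hXY hYX hX hY (x σ a) = X := lift_gen ..

theorem lift_y : lift σ a f X Y hXY hYX hX hY (y σ a) = Y := lift_gen ..

end

theorem hom_ext {f g : GWA σ a →ₐ[k] B} (hc : f.comp (coeHom σ a) = g.comp (coeHom σ a))
    (hx : f (x σ a) = g (x σ a)) (hy : f (y σ a) = g (y σ a)) : f = g := by
  refine RingQuot.ringQuot_ext' k _ _ ?_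
  refine FreeAlgebra.hom_ext ?_
  funext z
  cases z with
  | coe r => exact DFunLike.congr_fun hc r
  | x => exact hx
  | y => exact hy

/-- A subalgebra containing the generators is everything. -/
theorem mem_subalgebra (S : Subalgebra k (GWA σ a)) (hc : ∀ r, coe σ a r ∈ S) (hx : x σ a ∈ S)
    (hy : y σ a ∈ S) (b : GWA σ a) : b ∈ S := by
  -- The universal property gives a map into `S` which, followed by the inclusion, fixes the
  -- generators. So it is the identity, and every element is a value of the inclusion.
  have key : S.val.comp (lift (B := S) σ a ((coeHom σ a).codRestrict S hc) ⟨_, hx⟩ ⟨_, hy⟩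
      (Subtype.ext (x_mul_y σ a)) (Subtype.ext (y_mul_x σ a))
      (fun r => Subtype.ext (x_mul_coe σ a r)) (fun r => Subtype.ext (y_mul_coe σ a r)))
      = AlgHom.id k _ := by
    refine hom_ext σ a ?_ ?_ ?_
    · ext1 r
      simp only [AlgHom.comp_apply, coeHom_apply, lift_coe]
      rfl
    · simp only [AlgHom.comp_apply, lift_x]
      rfl
    · simp only [AlgHom.comp_apply, lift_y]
      rfl
  have h1 := DFunLike.congr_fun key b
  rw [AlgHom.comp_apply, AlgHom.id_apply] at h1
  rw [← h1]
  exact Subtype.property _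

end GWA

/-! ### The presentation of `A(1, q)` and its flip automorphism -/

section A₁

variable {k : Type*} [Field k] (q : kˣ) {B : Type*} [Ring B] [Algebra k B]

/-- The homomorphism `k[h, h⁻¹] → B` which sends `h` to a given unit. -/
def laurentLift (H : Bˣ) : LaurentPolynomial k →ₐ[k] B :=
  AddMonoidAlgebra.lift k B ℤ ((Units.coeHom B).comp (zpowersHom Bˣ H))

theorem laurentLift_T (H : Bˣ) (m : ℤ) :
    laurentLift (k := k) H (LaurentPolynomial.T m) = ((H ^ m : Bˣ) : B) := by
  refine (AddMonoidAlgebra.lift_single _ _ _).trans ?_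
  simp

theorem laurent_hom_ext {f g : LaurentPolynomial k →ₐ[k] B}
    (hfg : f (LaurentPolynomial.T 1) = g (LaurentPolynomial.T 1)) : f = g := by
  refine AddMonoidAlgebra.algHom_ext' (MonoidHom.ext_mint (M := B) ?_) (Subsingleton.elim _ _)
  exact hfg

theorem sigma₁_T (m : ℤ) : sigma₁ k q (LaurentPolynomial.T m) =
    ((q ^ m : kˣ) : k) • LaurentPolynomial.T m := by
  refine (twistHom_single _ _ _).trans ?_
  rw [LaurentPolynomial.T, AddMonoidAlgebra.smul_single]
  simp

theorem sigma₁_symm_T (m : ℤ) : (sigma₁ k q).symm (LaurentPolynomial.T m) =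
    ((q⁻¹ ^ m : kˣ) : k) • LaurentPolynomial.T m := by
  refine (twistHom_single _ _ _).trans ?_
  rw [LaurentPolynomial.T, AddMonoidAlgebra.smul_single]
  simp

/-- Commutation with `H` up to the scalar `c` extends to every integer power because `H` is a unit.
The automorphism `s` is kept abstract so that the result covers both `x` with `σ` and `y` with
`σ⁻¹`. -/
theorem laurentLift_semiconj (H : Bˣ) (X : B) (c : kˣ) (hX : X * H = (c : k) • (H * X))
    (s : LaurentPolynomial k →ₐ[k] LaurentPolynomial k)
    (hs : ∀ m, s (LaurentPolynomial.T m) = ((c ^ m : kˣ) : k) • LaurentPolynomial.T m)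
    (r : LaurentPolynomial k) :
    X * laurentLift H r = laurentLift H (s r) * X := by
  induction r using AddMonoidAlgebra.induction_linear with
  | zero => simp
  | add p p' hp hp' => rw [map_add, map_add, map_add, mul_add, add_mul, hp, hp']
  | single m d =>
    have h0 : AddMonoidAlgebra.single m d = d • LaurentPolynomial.T (R := k) m := by
      rw [LaurentPolynomial.T, AddMonoidAlgebra.smul_single, smul_eq_mul, mul_one]
    have h1 : SemiconjBy X (H : B) ((Units.map (algebraMap k B : k →* B) c * H : Bˣ) : B) := by
      rw [SemiconjBy, hX]
      simp [Algebra.smul_def, mul_assoc]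
    have h2 := (h1.units_zpow_right m).eq
    have h3 : Commute (Units.map (algebraMap k B : k →* B) c) H :=
      Units.ext (Algebra.commutes (c : k) (H : B))
    rw [h3.mul_zpow, ← map_zpow] at h2
    rw [h0, map_smul, map_smul, map_smul, hs, map_smul, laurentLift_T, mul_smul_comm, h2]
    simp only [Units.val_mul, Units.coe_map, MonoidHom.coe_coe, Algebra.smul_def,
      mul_assoc]

/-- The universal property of `A(1, q)`. -/
def A₁.lift (H : Bˣ) (X Y : B) (hX : X * H = (q : k) • (H * X))
    (hY : Y * H = (q : k)⁻¹ • (H * Y)) (hXY : X * Y = (q : k) • (H : B) - 1)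
    (hYX : Y * X = H - 1) : A₁ k 1 q →ₐ[k] B :=
  GWA.lift _ _ (laurentLift H) X Y
    (by
      rw [map_sub, map_pow, map_one, sigma₁_T, map_sub, map_pow, map_smul, laurentLift_T, map_one,
        hXY]
      simp)
    (by rw [map_sub, map_pow, map_one, laurentLift_T, hYX]; simp)
    (laurentLift_semiconj H X q hX (sigma₁ k q) (sigma₁_T q))
    (laurentLift_semiconj H Y q⁻¹ (by rw [hY, Units.val_inv_eq_inv_val])
      ((sigma₁ k q).symm : LaurentPolynomial k →ₐ[k] LaurentPolynomial k) (sigma₁_symm_T q))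

/-- The unit `h` of `A(1, q)`. -/
def A₁.h : (A₁ k 1 q)ˣ where
  val := GWA.coe _ _ (LaurentPolynomial.T 1)
  inv := GWA.coe _ _ (LaurentPolynomial.T (-1))
  val_inv := by rw [← GWA.coe_mul, ← LaurentPolynomial.T_add]; exact GWA.coe_one _ _
  inv_val := by rw [← GWA.coe_mul, ← LaurentPolynomial.T_add]; exact GWA.coe_one _ _

/-- The generator `x` of `A(1, q)`. -/
def A₁.x : A₁ k 1 q := GWA.x _ _

/-- The generator `y` of `A(1, q)`. -/
def A₁.y : A₁ k 1 q := GWA.y _ _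

theorem A₁.coe_smul (c : k) (r : LaurentPolynomial k) :
    (GWA.coe _ _ (c • r) : A₁ k 1 q) = c • GWA.coe _ _ r :=
  map_smul (GWA.coeHom (sigma₁ k q) (LaurentPolynomial.T 1 ^ 1 - 1)) c r

theorem A₁.coe_sub (r s : LaurentPolynomial k) :
    (GWA.coe _ _ (r - s) : A₁ k 1 q) = GWA.coe _ _ r - GWA.coe _ _ s :=
  map_sub (GWA.coeHom (sigma₁ k q) (LaurentPolynomial.T 1 ^ 1 - 1)) r s

theorem A₁.x_mul_h : A₁.x q * A₁.h q = (q : k) • (A₁.h q * A₁.x q) := by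
  refine (GWA.x_mul_coe _ _ _).trans ?_
  rw [sigma₁_T, A₁.coe_smul, zpow_one, smul_mul_assoc]
  rfl

theorem A₁.y_mul_h : A₁.y q * A₁.h q = (q : k)⁻¹ • (A₁.h q * A₁.y q) := by
  refine (GWA.y_mul_coe _ _ _).trans ?_
  rw [sigma₁_symm_T, A₁.coe_smul, zpow_one, smul_mul_assoc, Units.val_inv_eq_inv_val]
  rfl

theorem A₁.x_mul_y : A₁.x q * A₁.y q = (q : k) • (A₁.h q : A₁ k 1 q) - 1 := by
  refine (GWA.x_mul_y _ _).trans ?_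
  have h1 : sigma₁ k q (LaurentPolynomial.T 1 ^ 1 - 1)
      = (q : k) • LaurentPolynomial.T 1 - 1 := by
    rw [pow_one, map_sub, map_one, sigma₁_T, zpow_one]
  exact (congrArg _ h1).trans ((A₁.coe_sub q _ _).trans
    (congrArg₂ _ (A₁.coe_smul q _ _) (GWA.coe_one _ _)))

theorem A₁.y_mul_x : A₁.y q * A₁.x q = (A₁.h q : A₁ k 1 q) - 1 := by
  refine (GWA.y_mul_x _ _).trans ?_
  have h1 : (LaurentPolynomial.T 1 ^ 1 - 1 : LaurentPolynomial k) = LaurentPolynomial.T 1 - 1 := by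
    rw [pow_one]
  exact (congrArg _ h1).trans ((A₁.coe_sub q _ _).trans (congrArg₂ _ rfl (GWA.coe_one _ _)))

theorem A₁.hom_ext {f g : A₁ k 1 q →ₐ[k] B} (hh : f (A₁.h q) = g (A₁.h q))
    (hx : f (A₁.x q) = g (A₁.x q)) (hy : f (A₁.y q) = g (A₁.y q)) : f = g :=
  GWA.hom_ext _ _ (laurent_hom_ext hh) hx hy

section

variable (H : Bˣ) (X Y : B) (hX : X * H = (q : k) • (H * X))
    (hY : Y * H = (q : k)⁻¹ • (H * Y)) (hXY : X * Y = (q : k) • (H : B) - 1)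
    (hYX : Y * X = H - 1)

theorem A₁.lift_h : A₁.lift q H X Y hX hY hXY hYX (A₁.h q) = H := by
  refine (GWA.lift_coe ..).trans ?_
  rw [laurentLift_T, zpow_one]

theorem A₁.lift_x : A₁.lift q H X Y hX hY hXY hYX (A₁.x q) = X := GWA.lift_x ..

theorem A₁.lift_y : A₁.lift q H X Y hX hY hXY hYX (A₁.y q) = Y := GWA.lift_y ..

end

theorem mul_inv_of_mul_eq_smul {H : Bˣ} {X : B} {c : k} (hc : c ≠ 0)
    (hX : X * H = c • (H * X)) : X * ↑H⁻¹ = c⁻¹ • (↑H⁻¹ * X) := by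
  rw [Units.mul_inv_eq_iff_eq_mul, smul_mul_assoc, mul_assoc, hX, mul_smul_comm, smul_smul,
    inv_mul_cancel₀ hc, one_smul, Units.inv_mul_cancel_left]

theorem A₁.x_mul_h_inv : A₁.x q * ↑(A₁.h q)⁻¹ = (q : k)⁻¹ • (↑(A₁.h q)⁻¹ * A₁.x q) :=
  mul_inv_of_mul_eq_smul q.ne_zero (A₁.x_mul_h q)

theorem A₁.y_mul_h_inv : A₁.y q * ↑(A₁.h q)⁻¹ = (q : k) • (↑(A₁.h q)⁻¹ * A₁.y q) := by
  rw [mul_inv_of_mul_eq_smul (inv_ne_zero q.ne_zero) (A₁.y_mul_h q), inv_inv]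

/-- The unit `q⁻¹ h⁻¹` of `A(1, q)`. -/
def A₁.hFlip : (A₁ k 1 q)ˣ :=
  Units.map (algebraMap k (A₁ k 1 q) : k →* A₁ k 1 q) q⁻¹ * (A₁.h q)⁻¹

theorem A₁.coe_hFlip : (A₁.hFlip q : A₁ k 1 q) = (q : k)⁻¹ • (↑(A₁.h q)⁻¹ : A₁ k 1 q) := by
  rw [Algebra.smul_def, ← Units.val_inv_eq_inv_val]
  rfl

theorem A₁.coe_hFlip_inv : (↑(A₁.hFlip q)⁻¹ : A₁ k 1 q) = (q : k) • (A₁.h q : A₁ k 1 q) := by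
  rw [Units.inv_eq_of_mul_eq_one_right]
  rw [A₁.coe_hFlip, smul_mul_smul_comm, inv_mul_cancel₀ q.ne_zero, Units.inv_mul, one_smul]

/-- The endomorphism of `A(1, q)` with `h ↦ q⁻¹ h⁻¹`, `x ↦ -h⁻¹ y`, `y ↦ x`. -/
def A₁.flipHom : A₁ k 1 q →ₐ[k] A₁ k 1 q :=
  A₁.lift q (A₁.hFlip q) (-(↑(A₁.h q)⁻¹ * A₁.y q)) (A₁.x q)
    (by
      rw [A₁.coe_hFlip, mul_smul_comm, smul_mul_assoc, smul_smul, mul_inv_cancel₀ q.ne_zero,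
        neg_mul, mul_assoc, A₁.y_mul_h_inv, mul_smul_comm, smul_neg, smul_smul,
        inv_mul_cancel₀ q.ne_zero, one_smul, one_smul, mul_neg])
    (by rw [A₁.coe_hFlip, mul_smul_comm, smul_mul_assoc, A₁.x_mul_h_inv])
    (by
      rw [A₁.coe_hFlip, smul_smul, mul_inv_cancel₀ q.ne_zero, one_smul, neg_mul, mul_assoc,
        A₁.y_mul_x, mul_sub, Units.inv_mul, mul_one, neg_sub])
    (by
      rw [A₁.coe_hFlip, mul_neg, ← mul_assoc, A₁.x_mul_h_inv, smul_mul_assoc, mul_assoc,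
        A₁.x_mul_y, mul_sub, mul_smul_comm, Units.inv_mul, mul_one, smul_sub, smul_smul,
        inv_mul_cancel₀ q.ne_zero, one_smul, neg_sub])

/-- The inverse of `flipHom`: `h ↦ q⁻¹ h⁻¹`, `x ↦ y`, `y ↦ -q⁻¹ h⁻¹ x`. -/
def A₁.flipInv : A₁ k 1 q →ₐ[k] A₁ k 1 q :=
  A₁.lift q (A₁.hFlip q) (A₁.y q) (-(A₁.hFlip q * A₁.x q))
    (by
      rw [A₁.coe_hFlip, mul_smul_comm, smul_mul_assoc, smul_smul, mul_inv_cancel₀ q.ne_zero,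
        A₁.y_mul_h_inv, smul_smul, inv_mul_cancel₀ q.ne_zero])
    (by
      simp only [A₁.coe_hFlip, neg_mul, mul_neg, mul_smul_comm, smul_mul_assoc, mul_assoc,
        A₁.x_mul_h_inv, smul_neg])
    (by
      rw [A₁.coe_hFlip, smul_mul_assoc, mul_neg, mul_smul_comm, ← mul_assoc, A₁.y_mul_h_inv,
        smul_mul_assoc, smul_smul, smul_smul, mul_inv_cancel₀ q.ne_zero, inv_mul_cancel₀ q.ne_zero,
        one_smul, one_smul, mul_assoc, A₁.y_mul_x, mul_sub, Units.inv_mul, mul_one, neg_sub])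
    (by
      rw [A₁.coe_hFlip, neg_mul, mul_assoc, A₁.x_mul_y, mul_sub, mul_one, smul_mul_smul_comm,
        inv_mul_cancel₀ q.ne_zero, Units.inv_mul, one_smul, neg_sub])

/-- Homomorphisms preserve inverses of units. Both `flipHom` and `flipInv` satisfy the hypothesis,
so both are involutive on `h`. -/
theorem A₁.map_inv_of_map {f : A₁ k 1 q →ₐ[k] A₁ k 1 q}
    (hf : f (A₁.h q) = A₁.hFlip q) : f ↑(A₁.h q)⁻¹ = (q : k) • (A₁.h q : A₁ k 1 q) := by
  have h1 : Units.map (f : A₁ k 1 q →* A₁ k 1 q) (A₁.h q) = A₁.hFlip q := Units.ext hf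
  rw [← A₁.coe_hFlip_inv, ← h1, ← map_inv]
  rfl

/-- The automorphism of `A(1, q)` with `h ↦ q⁻¹ h⁻¹`, `x ↦ -h⁻¹ y`, `y ↦ x`. -/
def A₁.flip : A₁ k 1 q ≃ₐ[k] A₁ k 1 q :=
  AlgEquiv.ofAlgHom (A₁.flipHom q) (A₁.flipInv q)
    (by
      have hh : A₁.flipHom q (A₁.h q) = A₁.hFlip q := A₁.lift_h ..
      have hx : A₁.flipHom q (A₁.x q) = _ := A₁.lift_x ..
      have hy : A₁.flipHom q (A₁.y q) = _ := A₁.lift_y ..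
      have hh' : A₁.flipInv q (A₁.h q) = A₁.hFlip q := A₁.lift_h ..
      have hx' : A₁.flipInv q (A₁.x q) = _ := A₁.lift_x ..
      have hy' : A₁.flipInv q (A₁.y q) = _ := A₁.lift_y ..
      have hF : A₁.flipHom q (A₁.hFlip q) = A₁.h q := by
        rw [A₁.coe_hFlip, map_smul, A₁.map_inv_of_map q hh, smul_smul, inv_mul_cancel₀ q.ne_zero,
          one_smul]
      refine A₁.hom_ext q ?_ ?_ ?_
      · rw [AlgHom.comp_apply, hh', hF, AlgHom.id_apply]
      · rw [AlgHom.comp_apply, hx', hy, AlgHom.id_apply]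
      · rw [AlgHom.comp_apply, hy', map_neg, map_mul, hF, hx, mul_neg, neg_neg,
          Units.mul_inv_cancel_left, AlgHom.id_apply])
    (by
      have hh : A₁.flipHom q (A₁.h q) = A₁.hFlip q := A₁.lift_h ..
      have hx : A₁.flipHom q (A₁.x q) = _ := A₁.lift_x ..
      have hy : A₁.flipHom q (A₁.y q) = _ := A₁.lift_y ..
      have hh' : A₁.flipInv q (A₁.h q) = A₁.hFlip q := A₁.lift_h ..
      have hx' : A₁.flipInv q (A₁.x q) = _ := A₁.lift_x ..
      have hy' : A₁.flipInv q (A₁.y q) = _ := A₁.lift_y ..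
      refine A₁.hom_ext q ?_ ?_ ?_
      · rw [AlgHom.comp_apply, hh, A₁.coe_hFlip, map_smul, A₁.map_inv_of_map q hh', smul_smul,
          inv_mul_cancel₀ q.ne_zero, one_smul, AlgHom.id_apply]
      · rw [AlgHom.comp_apply, hx, map_neg, map_mul, A₁.map_inv_of_map q hh', hy', mul_neg,
          neg_neg, A₁.coe_hFlip, smul_mul_assoc, smul_mul_assoc, mul_smul_comm, smul_smul,
          mul_inv_cancel₀ q.ne_zero,
          one_smul, Units.mul_inv_cancel_left, AlgHom.id_apply]
      · rw [AlgHom.comp_apply, hy, hx', AlgHom.id_apply])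

theorem A₁.flip_h : A₁.flip q (A₁.h q) = A₁.hFlip q := A₁.lift_h ..

theorem A₁.flip_x : A₁.flip q (A₁.x q) = -(↑(A₁.h q)⁻¹ * A₁.y q) := A₁.lift_x ..

end A₁

/-! ### The isomorphism between `𝒜_{α,q}` and `A(1, q)` -/

section AAlg

variable {k : Type*} [Field k] (α q : kˣ)

/-- The generators `e₁, e₂, e₃` of `𝒜_{α,q}`. -/
def AAlg.e (i : Fin 3) : AAlg k α q := RingQuot.mkAlgHom k (ARel k α q) (FreeAlgebra.ι k i)

theorem AAlg.rel13 : AAlg.e α q 0 * AAlg.e α q 2 = (q : k)⁻¹ • (AAlg.e α q 2 * AAlg.e α q 0) := by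
  have h1 := RingQuot.mkAlgHom_rel k (ARel.rel13 (α := α) (q := q))
  simp only [map_mul, map_smul] at h1
  exact h1

theorem AAlg.rel23 : AAlg.e α q 1 * AAlg.e α q 2 =
    (q : k) • (AAlg.e α q 2 * AAlg.e α q 1) + (α : k) • 1 := by
  have h1 := RingQuot.mkAlgHom_rel k (ARel.rel23 (α := α) (q := q))
  simp only [map_mul, map_smul, map_add, AlgHom.commutes] at h1
  rw [← Algebra.algebraMap_eq_smul_one]
  exact h1

theorem AAlg.rel21 : AAlg.e α q 1 * AAlg.e α q 0 =
    (q : k)⁻¹ • (AAlg.e α q 0 * AAlg.e α q 1) - (q : k)⁻¹ • AAlg.e α q 2 := by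
  have h1 := RingQuot.mkAlgHom_rel k (ARel.rel21 (α := α) (q := q))
  simp only [map_mul, map_smul, map_sub] at h1
  exact h1

/-- Solved for `e₃²` and right-associated, so that it can act as a rewriting rule. -/
theorem AAlg.rel33 : AAlg.e α q 2 * AAlg.e α q 2 =
    -(((q : k) ^ 2 - 1) • (AAlg.e α q 2 * (AAlg.e α q 0 * AAlg.e α q 1)))
      - ((α : k) * q * (q + 1)) • AAlg.e α q 0 := by
  have h1 := RingQuot.mkAlgHom_rel k (ARel.rel33 (α := α) (q := q))
  simp only [map_mul, map_smul, map_add, map_zero, pow_two] at h1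
  have h2 : AAlg.e α q 2 * AAlg.e α q 2
    + ((q : k) * q - 1) • (AAlg.e α q 2 * AAlg.e α q 0 * AAlg.e α q 1)
    + ((α : k) * q * (q + 1)) • AAlg.e α q 0 = 0 := h1
  rw [add_assoc, add_eq_zero_iff_eq_neg] at h2
  rw [h2, neg_add, ← sub_eq_add_neg, pow_two, mul_assoc]

theorem AAlg.hom_ext {B : Type*} [Ring B] [Algebra k B] {f g : AAlg k α q →ₐ[k] B}
    (hfg : ∀ i, f (AAlg.e α q i) = g (AAlg.e α q i)) : f = g := by
  refine RingQuot.ringQuot_ext' k _ _ (FreeAlgebra.hom_ext (funext hfg))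

/-- The form of a relation that also applies in the middle of a right-associated word. -/
theorem mul_assoc_of_eq {B : Type*} [Semigroup B] {a b c : B} (h : a * b = c) (d : B) :
    a * (b * d) = c * d := by rw [← mul_assoc, h]

theorem q_add_one_ne_zero {q : kˣ} (hq : (q : k) ^ 2 ≠ 1) : (q : k) + 1 ≠ 0 := fun h1 =>
  hq (by linear_combination ((q : k) - 1) * h1)

theorem q_sub_one_ne_zero {q : kˣ} (hq : (q : k) ^ 2 ≠ 1) : (q : k) - 1 ≠ 0 := fun h1 =>
  hq (by linear_combination ((q : k) + 1) * h1)

/-- The element of `𝒜_{α,q}` that corresponds to `h⁻¹`. -/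
def AAlg.hInv : AAlg k α q :=
  -- In `A(1, q)` one has `h⁻¹y²x² = q⁻¹h - q⁻¹ - 1 + h⁻¹`. Solving for `h⁻¹` and writing `h⁻¹y²` as
  -- a multiple of `e₁` gives this element.
  1 - (((q : k) - 1) / α * (q : k)⁻¹) • (AAlg.e α q 2 * AAlg.e α q 1
    + ((q : k) ^ 2 - 1) • (AAlg.e α q 0 * (AAlg.e α q 1 * AAlg.e α q 1)))

/-- The unit of `𝒜_{α,q}` that corresponds to `h`. -/
def AAlg.hUnit : (AAlg k α q)ˣ where
  val := 1 + (((q : k) - 1) / α) • (AAlg.e α q 2 * AAlg.e α q 1)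
  inv := AAlg.hInv α q
  val_inv := by
    have h13 := AAlg.rel13 α q
    have h23 := AAlg.rel23 α q
    have h21 := AAlg.rel21 α q
    have h33 := AAlg.rel33 α q
    rw [AAlg.hInv]
    generalize AAlg.e α q 0 = e at *
    generalize AAlg.e α q 1 = f at *
    generalize AAlg.e α q 2 = g at *
    have hq0 := q.ne_zero
    have ha0 := α.ne_zero
    -- Read from left to right, the relations move `e₃` to the front and `e₂` to the end and
    -- eliminate `e₃²`. Both sides reduce to normal words, whose scalars are then compared.
    simp only [mul_add, mul_sub, add_mul, sub_mul, neg_mul, mul_neg, one_mul, mul_one,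
      smul_mul_assoc, mul_smul_comm, mul_assoc, h13, h23, h21, h33,
      mul_assoc_of_eq h13, mul_assoc_of_eq h23, mul_assoc_of_eq h21, mul_assoc_of_eq h33]
    match_scalars <;> field_simp <;> ring
  inv_val := by
    have h13 := AAlg.rel13 α q
    have h23 := AAlg.rel23 α q
    have h21 := AAlg.rel21 α q
    have h33 := AAlg.rel33 α q
    rw [AAlg.hInv]
    generalize AAlg.e α q 0 = e at *
    generalize AAlg.e α q 1 = f at *
    generalize AAlg.e α q 2 = g at *
    have hq0 := q.ne_zero
    have ha0 := α.ne_zero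
    simp only [mul_add, mul_sub, add_mul, sub_mul, neg_mul, mul_neg, one_mul, mul_one,
      smul_mul_assoc, mul_smul_comm, mul_assoc, h13, h23, h21, h33,
      mul_assoc_of_eq h13, mul_assoc_of_eq h23, mul_assoc_of_eq h21, mul_assoc_of_eq h33]
    match_scalars <;> field_simp <;> ring

/-- The homomorphism `A(1, q) → 𝒜_{α,q}` with `x ↦ e₂` and `y ↦ ((q - 1) / α) e₃`. -/
def AAlg.ofA₁ : A₁ k 1 q →ₐ[k] AAlg k α q :=
  A₁.lift q (AAlg.hUnit α q) (AAlg.e α q 1) ((((q : k) - 1) / α) • AAlg.e α q 2)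
    (by
      have h23 := AAlg.rel23 α q
      simp only [AAlg.hUnit]
      have ha0 := α.ne_zero
      simp only [mul_add, add_mul, one_mul, mul_one, smul_mul_assoc, mul_smul_comm, mul_assoc,
        mul_assoc_of_eq h23]
      match_scalars <;> field_simp <;> ring)
    (by
      have h23 := AAlg.rel23 α q
      simp only [AAlg.hUnit]
      have ha0 := α.ne_zero
      have hq0 := q.ne_zero
      simp only [mul_add, add_mul, one_mul, mul_one, smul_mul_assoc, mul_smul_comm, mul_assoc,
        h23]
      match_scalars <;> field_simp <;> ring)
    (by
      have h23 := AAlg.rel23 α q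
      simp only [AAlg.hUnit]
      have ha0 := α.ne_zero
      simp only [mul_smul_comm, h23]
      match_scalars <;> field_simp)
    (by simp only [AAlg.hUnit, smul_mul_assoc, add_sub_cancel_left])

/-- The images of `e₁, e₂, e₃` in `A(1, q)`. -/
def AAlg.toA₁Gen : Fin 3 → A₁ k 1 q :=
  -- The scalar of `e₁` is forced by `rel21`, since `x(h⁻¹y²) - q⁻¹(h⁻¹y²)x = (1 - q⁻²)y`. This is
  -- where `q² ≠ 1` is needed.
  ![(-(q * α / ((q - 1) * ((q : k) ^ 2 - 1)))) • (↑(A₁.h q)⁻¹ * (A₁.y q * A₁.y q)), A₁.x q,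
    ((α : k) / (q - 1)) • A₁.y q]

/-- The homomorphism `𝒜_{α,q} → A(1, q)` inverse to `AAlg.ofA₁`. -/
def AAlg.toA₁ (hq : (q : k) ^ 2 ≠ 1) : AAlg k α q →ₐ[k] A₁ k 1 q :=
  RingQuot.liftAlgHom k ⟨FreeAlgebra.lift k (AAlg.toA₁Gen α q), by
    have hxK := A₁.x_mul_h_inv q
    have hyK := A₁.y_mul_h_inv q
    have hxy := A₁.x_mul_y q
    have hyx := A₁.y_mul_x q
    have hyH := A₁.y_mul_h q
    have hKH := Units.inv_mul (A₁.h q)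
    have hq0 := q.ne_zero
    have hq2 : (q : k) ^ 2 - 1 ≠ 0 := sub_ne_zero.2 hq
    have hq1 := q_sub_one_ne_zero hq
    have hq3 := q_add_one_ne_zero hq
    intro p p' hp
    cases hp with
    | rel13 =>
      simp only [AAlg.toA₁Gen, map_mul, map_smul, map_add, map_sub, map_zero, AlgHom.commutes,
        FreeAlgebra.lift_ι_apply, Matrix.cons_val, Algebra.algebraMap_eq_smul_one, pow_two]
      simp only [mul_add, mul_sub, add_mul, sub_mul, mul_one, one_mul,
        smul_mul_assoc, mul_smul_comm, mul_assoc, hxK, hyK, hxy, hyx, hyH, hKH,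
        mul_assoc_of_eq hxK, mul_assoc_of_eq hyK, mul_assoc_of_eq hxy, mul_assoc_of_eq hyx,
        mul_assoc_of_eq hyH, mul_assoc_of_eq hKH]
      match_scalars <;> field_simp <;> ring
    | rel23 =>
      simp only [AAlg.toA₁Gen, map_mul, map_smul, map_add, map_one,
        FreeAlgebra.lift_ι_apply, Matrix.cons_val, Algebra.algebraMap_eq_smul_one,
        smul_mul_assoc, mul_smul_comm, hxy, hyx]
      match_scalars <;> field_simp <;> ring
    | rel21 =>
      simp only [AAlg.toA₁Gen, map_mul, map_smul, map_add, map_sub, map_zero, AlgHom.commutes,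
        FreeAlgebra.lift_ι_apply, Matrix.cons_val, Algebra.algebraMap_eq_smul_one, pow_two]
      simp only [mul_add, mul_sub, add_mul, sub_mul, mul_one, one_mul,
        smul_mul_assoc, mul_smul_comm, mul_assoc, hxK, hyK, hxy, hyx, hyH, hKH,
        mul_assoc_of_eq hxK, mul_assoc_of_eq hyK, mul_assoc_of_eq hxy, mul_assoc_of_eq hyx,
        mul_assoc_of_eq hyH, mul_assoc_of_eq hKH]
      match_scalars <;> field_simp <;> ring
    | rel33 =>
      simp only [AAlg.toA₁Gen, map_mul, map_smul, map_add, map_sub, map_zero, AlgHom.commutes,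
        FreeAlgebra.lift_ι_apply, Matrix.cons_val, Algebra.algebraMap_eq_smul_one, pow_two]
      simp only [mul_add, mul_sub, add_mul, sub_mul, mul_one, one_mul,
        smul_mul_assoc, mul_smul_comm, mul_assoc, hxK, hyK, hxy, hyx, hyH, hKH,
        mul_assoc_of_eq hxK, mul_assoc_of_eq hyK, mul_assoc_of_eq hxy, mul_assoc_of_eq hyx,
        mul_assoc_of_eq hyH, mul_assoc_of_eq hKH]
      match_scalars <;> field_simp <;> ring⟩

theorem AAlg.toA₁_e (hq : (q : k) ^ 2 ≠ 1) (i : Fin 3) :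
    AAlg.toA₁ α q hq (AAlg.e α q i) = AAlg.toA₁Gen α q i := by
  refine (RingQuot.liftAlgHom_mkAlgHom_apply k _ _ _).trans ?_
  rw [FreeAlgebra.lift_ι_apply]

/-- The isomorphism between `𝒜_{α,q}` and `A(1, q)`. -/
def AAlg.equivA₁ (hq : (q : k) ^ 2 ≠ 1) : AAlg k α q ≃ₐ[k] A₁ k 1 q :=
  AlgEquiv.ofAlgHom (AAlg.toA₁ α q hq) (AAlg.ofA₁ α q)
    (by
      have hx : AAlg.ofA₁ α q (A₁.x q) = _ := A₁.lift_x ..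
      have hy : AAlg.ofA₁ α q (A₁.y q) = _ := A₁.lift_y ..
      have hh : AAlg.ofA₁ α q (A₁.h q) = _ := A₁.lift_h ..
      have hq1 := q_sub_one_ne_zero hq
      have ha0 := α.ne_zero
      refine A₁.hom_ext q ?_ ?_ ?_
      · rw [AlgHom.comp_apply, hh]
        simp only [AAlg.hUnit, map_add, map_one, map_smul, map_mul, AAlg.toA₁_e, AAlg.toA₁Gen,
          Matrix.cons_val, smul_mul_assoc, A₁.y_mul_x, AlgHom.id_apply]
        match_scalars <;> field_simp <;> ring
      · rw [AlgHom.comp_apply, hx, AAlg.toA₁_e]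
        rfl
      · rw [AlgHom.comp_apply, hy, map_smul, AAlg.toA₁_e]
        simp only [AAlg.toA₁Gen, Matrix.cons_val, AlgHom.id_apply]
        match_scalars <;> field_simp)
    (by
      have hx : AAlg.ofA₁ α q (A₁.x q) = _ := A₁.lift_x ..
      have hy : AAlg.ofA₁ α q (A₁.y q) = _ := A₁.lift_y ..
      have hh : AAlg.ofA₁ α q (A₁.h q) = AAlg.hUnit α q := A₁.lift_h ..
      have hK : AAlg.ofA₁ α q ↑(A₁.h q)⁻¹ = ↑(AAlg.hUnit α q)⁻¹ := by
        have h1 : Units.map (AAlg.ofA₁ α q : A₁ k 1 q →* AAlg k α q) (A₁.h q) = AAlg.hUnit α q :=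
          Units.ext hh
        rw [← h1, ← map_inv]
        rfl
      have hq1 := q_sub_one_ne_zero hq
      have hq3 := q_add_one_ne_zero hq
      have hq2 : (q : k) ^ 2 - 1 ≠ 0 := sub_ne_zero.2 hq
      have hq0 := q.ne_zero
      have ha0 := α.ne_zero
      refine AAlg.hom_ext α q fun i => ?_
      rw [AlgHom.comp_apply, AAlg.toA₁_e, AlgHom.id_apply]
      fin_cases i
      · simp only [AAlg.toA₁Gen, Fin.zero_eta, Matrix.cons_val, map_smul, map_mul, hK, hy]
        -- After multiplication by the unit `h`, the claim identifies a multiple of `e₃²` with `h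
        -- e₁`, which is `rel33` after reordering `e₂e₁`.
        rw [← mul_smul_comm, Units.inv_mul_eq_iff_eq_mul]
        have h21 := AAlg.rel21 α q
        have h33 := AAlg.rel33 α q
        simp only [AAlg.hUnit, add_mul, one_mul, mul_sub, smul_mul_assoc, mul_smul_comm, mul_assoc,
          h21, h33]
        match_scalars <;> field_simp <;> ring
      · exact hx
      · simp only [AAlg.toA₁Gen, Fin.reduceFinMk, Matrix.cons_val, map_smul, hy]
        match_scalars <;> field_simp)

end AAlg

/-! ### Factors of monomials in skew group algebras -/

section SkewMonoidAlgebra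

open SkewMonoidAlgebra

variable {R G : Type*} [Ring R] [IsDomain R] [Group G] [MulSemiringAction G R]

/-- Any other nonzero term of the convolution at `a * b` would be a second factorization over the
supports. -/
theorem skew_coeff_mul_of_uniqueMul {f g : SkewMonoidAlgebra R G} {a b : G}
    (hu : UniqueMul f.support g.support a b) :
    (f * g).coeff (a * b) = f.coeff a * a • g.coeff b := by
  classical
  rw [coeff_mul_left, SkewMonoidAlgebra.sum_def, Finsupp.sum]
  refine (Finset.sum_eq_single a ?_ ?_).trans ?_
  · intro a' ha' hne
    by_cases hb : g.coeff (a'⁻¹ * (a * b)) = 0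
    · rw [hb, smul_zero, mul_zero]
    · exact absurd (hu ha' (mem_support_iff.2 hb) (mul_inv_cancel_left a' (a * b))).1 hne
  · intro ha
    rw [Finsupp.notMem_support_iff.1 ha, zero_mul]
  · rw [inv_mul_cancel_left]

theorem skew_mul_ne_zero_of_mem {f g : SkewMonoidAlgebra R G} {a b : G} (ha : a ∈ f.support)
    (hb : b ∈ g.support) : f.coeff a * a • g.coeff b ≠ 0 :=
  mul_ne_zero (mem_support_iff.1 ha) fun h0 =>
    mem_support_iff.1 hb ((smul_eq_zero_iff_eq a).1 h0)

theorem eq_single_of_card_support {f : SkewMonoidAlgebra R G} (hf : f.support.card = 1) :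
    ∃ a r, f = single a r := by
  obtain ⟨a, r, -, hf'⟩ := Finsupp.card_support_eq_one'.1 hf
  exact ⟨a, r, by rw [← ofCoeff_single, ← hf']⟩

/-- The factors of a monomial of a skew group algebra over a group with unique products are
monomials. -/
theorem skew_eq_single_of_mul_eq_single [TwoUniqueProds G] {f g : SkewMonoidAlgebra R G} {c : G}
    {r : R} (hr : r ≠ 0) (hfg : f * g = single c r) :
    ∃ a s b t, f = single a s ∧ g = single b t := by
  classical
  have hf : f ≠ 0 := by
    rintro rfl
    rw [zero_mul, eq_comm, single_eq_zero] at hfg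
    exact hr hfg
  have hg : g ≠ 0 := by
    rintro rfl
    rw [mul_zero, eq_comm, single_eq_zero] at hfg
    exact hr hfg
  have hf1 : 0 < f.support.card := Finset.card_pos.2
    (Finset.nonempty_iff_ne_empty.2 fun h0 => hf (support_eq_empty.1 h0))
  have hg1 : 0 < g.support.card := Finset.card_pos.2
    (Finset.nonempty_iff_ne_empty.2 fun h0 => hg (support_eq_empty.1 h0))
  -- Otherwise there are two distinct uniquely represented products. Each has a nonzero coefficient
  -- in `f * g`, so both equal `c`, which contradicts the uniqueness.
  have key : f.support.card * g.support.card ≤ 1 := by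
    by_contra! hlt
    obtain ⟨p, hp, p', hp', hne, hu, hu'⟩ := TwoUniqueProds.uniqueMul_of_one_lt_card hlt
    rw [Finset.mem_product] at hp hp'
    have aux : ∀ p : G × G, p.1 ∈ f.support → p.2 ∈ g.support →
        UniqueMul f.support g.support p.1 p.2 → p.1 * p.2 = c := by
      intro p h1 h2 hu
      by_contra hc
      apply skew_mul_ne_zero_of_mem h1 h2
      rw [← skew_coeff_mul_of_uniqueMul hu, hfg, coeff_single_apply, if_neg (Ne.symm hc)]
    have h1 := aux p hp.1 hp.2 hu
    have h2 := aux p' hp'.1 hp'.2 hu'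
    have h3 := hu hp'.1 hp'.2 (h2.trans h1.symm)
    exact hne (Prod.ext h3.1.symm h3.2.symm)
  have hf2 : f.support.card = 1 := by nlinarith
  have hg2 : g.support.card = 1 := by nlinarith
  obtain ⟨a, s, h1⟩ := eq_single_of_card_support hf2
  obtain ⟨b, t, h2⟩ := eq_single_of_card_support hg2
  exact ⟨a, s, b, t, h1, h2⟩

/-- A uniquely represented product of support elements has a nonzero coefficient, since `R` is a
domain and the group acts injectively. -/
theorem skew_noZeroDivisors [TwoUniqueProds G] : NoZeroDivisors (SkewMonoidAlgebra R G) where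
  eq_zero_or_eq_zero_of_mul_eq_zero {f g} hfg := by
    by_contra! hne
    obtain ⟨a, ha, b, hb, hu⟩ := UniqueProds.uniqueMul_of_nonempty
      (Finset.nonempty_iff_ne_empty.2 fun h0 => hne.1 (support_eq_empty.1 h0))
      (Finset.nonempty_iff_ne_empty.2 fun h0 => hne.2 (support_eq_empty.1 h0))
    apply skew_mul_ne_zero_of_mem ha hb
    rw [← skew_coeff_mul_of_uniqueMul hu, hfg]
    rfl

end SkewMonoidAlgebra

/-- Units of a group algebra over a field are monomials if the group has unique sums. -/
theorem addMonoidAlgebra_unit_eq_single {k G : Type*} [Field k] [AddCommGroup G]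
    [TwoUniqueSums G] {f g : AddMonoidAlgebra k G} (hfg : f * g = 1) :
    ∃ m c, c ≠ 0 ∧ f = AddMonoidAlgebra.single m c := by
  classical
  have hf : f ≠ 0 := left_ne_zero_of_mul_eq_one hfg
  have hg : g ≠ 0 := right_ne_zero_of_mul_eq_one hfg
  have hf0 : f.coeff ≠ 0 := fun h0 => hf (AddMonoidAlgebra.coeff_eq_zero.1 h0)
  have hg0 : g.coeff ≠ 0 := fun h0 => hg (AddMonoidAlgebra.coeff_eq_zero.1 h0)
  have hf1 : 0 < f.coeff.support.card := Finset.card_pos.2 (Finsupp.support_nonempty_iff.2 hf0)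
  have hg1 : 0 < g.coeff.support.card := Finset.card_pos.2 (Finsupp.support_nonempty_iff.2 hg0)
  have key : f.coeff.support.card * g.coeff.support.card ≤ 1 := by
    by_contra! hlt
    obtain ⟨p, hp, p', hp', hne, hu, hu'⟩ := TwoUniqueSums.uniqueAdd_of_one_lt_card hlt
    rw [Finset.mem_product] at hp hp'
    have aux : ∀ p : G × G, p.1 ∈ f.coeff.support → p.2 ∈ g.coeff.support →
        UniqueAdd f.coeff.support g.coeff.support p.1 p.2 → p.1 + p.2 = 0 := by
      intro p h1 h2 hu
      by_contra hc
      apply mul_ne_zero (Finsupp.mem_support_iff.1 h1) (Finsupp.mem_support_iff.1 h2)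
      rw [← AddMonoidAlgebra.coeff_mul_add_of_uniqueAdd hu, hfg, AddMonoidAlgebra.one_def,
        AddMonoidAlgebra.coeff_single, Finsupp.single_apply, if_neg (Ne.symm hc)]
    have h1 := aux p hp.1 hp.2 hu
    have h2 := aux p' hp'.1 hp'.2 hu'
    have h3 := hu hp'.1 hp'.2 (h2.trans h1.symm)
    exact hne (Prod.ext h3.1.symm h3.2.symm)
  have hf2 : f.coeff.support.card = 1 := by nlinarith
  obtain ⟨m, c, hc, hf'⟩ := Finsupp.card_support_eq_one'.1 hf2
  exact ⟨m, c, hc, AddMonoidAlgebra.coeff_injective (by rw [hf', AddMonoidAlgebra.coeff_single])⟩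

/-! ### The quantum torus -/

section Torus

variable {k : Type*} [Field k] (n : ℕ) (q : kˣ)

/-- The group `ℤⁿ`, which acts on `k[h_1^{±1}, …, h_n^{±1}]` by `q`-shifts. -/
def QShift (_q : kˣ) : Type := Multiplicative (Fin n → ℤ)

instance : CommGroup (QShift n q) := inferInstanceAs (CommGroup (Multiplicative (Fin n → ℤ)))

instance : TwoUniqueProds (QShift n q) :=
  inferInstanceAs (TwoUniqueProds (Multiplicative (Fin n → ℤ)))

/-- The shift by a vector of integers. -/
def QShift.of (d : Fin n → ℤ) : QShift n q := Multiplicative.ofAdd d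

/-- The vector of integers of a shift. -/
def QShift.vec {n : ℕ} {q : kˣ} (g : QShift n q) : Fin n → ℤ := Multiplicative.toAdd g

theorem QShift.vec_mul (g g' : QShift n q) : (g * g').vec = g.vec + g'.vec := rfl

theorem QShift.vec_one : (1 : QShift n q).vec = 0 := rfl

theorem QShift.of_add (d d' : Fin n → ℤ) :
    QShift.of n q (d + d') = QShift.of n q d * QShift.of n q d' := rfl

theorem QShift.of_zero : QShift.of n q 0 = 1 := rfl

theorem QShift.of_injective : Function.Injective (QShift.of n q) :=
  Multiplicative.ofAdd.injective

/-- The character by which a shift acts on monomials. -/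
def QShift.char {n : ℕ} {q : kˣ} (g : QShift n q) : Multiplicative (Fin n → ℤ) →* kˣ where
  toFun m := q ^ (∑ i, g.vec i * m.toAdd i)
  map_one' := by simp
  map_mul' m m' := by simp [mul_add, Finset.sum_add_distrib, zpow_add]

/-- A vector `g` scales the monomial of exponent `m` by `q` to the power `⟨g, m⟩`. The type `QShift
n q` carries `q` so that this action can be an instance. -/
instance : MulSemiringAction (QShift n q) (Laurent k n) where
  smul g p := twist g.char p
  one_smul p := by
    change twist _ p = p
    induction p using AddMonoidAlgebra.induction_linear with
    | zero => simp
    | add p p' hp hp' => rw [map_add, hp, hp']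
    | single m c =>
      refine (twistHom_single _ _ _).trans ?_
      simp [QShift.char, QShift.vec_one]
  mul_smul g g' p := by
    change twist _ p = twist _ (twist _ p)
    induction p using AddMonoidAlgebra.induction_linear with
    | zero => simp
    | add p p' hp hp' => rw [map_add, hp, hp', map_add, map_add]
    | single m c =>
      refine (twistHom_single _ _ _).trans ((?_ : _ = _).trans (congrArg _
        (twistHom_single _ _ _).symm))
      refine Eq.trans ?_ (twistHom_single _ _ _).symm
      congr 1
      simp [QShift.char, QShift.vec_mul, add_mul, Finset.sum_add_distrib, zpow_add₀ q.ne_zero]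
      ring
  smul_zero g := map_zero (twist g.char)
  smul_add g := map_add (twist g.char)
  smul_one g := map_one (twist g.char)
  smul_mul g := map_mul (twist g.char)

theorem QShift.smul_single (g : QShift n q) (m : Fin n → ℤ) (c : k) :
    g • (AddMonoidAlgebra.single m c : Laurent k n)
      = AddMonoidAlgebra.single m (c * ((q ^ (∑ i, g.vec i * m i) : kˣ) : k)) :=
  twistHom_single _ _ _

instance : SMulCommClass (QShift n q) k (Laurent k n) where
  smul_comm g c p := map_smul (twist g.char) c p

/-- On monomials, pairing with the `i`-th basis vector reads off the `i`-th exponent. Thus `σ_i` is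
conjugation by `t_i` in the quantum torus. -/
theorem sigma_eq_smul (i : Fin n) (p : Laurent k n) :
    sigma n q i p = QShift.of n q (Pi.single i 1) • p := by
  induction p using AddMonoidAlgebra.induction_linear with
  | zero => simp
  | add p p' hp hp' => rw [map_add, hp, hp', smul_add]
  | single m c =>
    rw [QShift.smul_single]
    refine (twistHom_single _ _ _).trans ?_
    simp [QShift.vec, QShift.of, Pi.single_apply]

/-- The quantum torus, as a skew group algebra. -/
abbrev Torus : Type _ := SkewMonoidAlgebra (Laurent k n) (QShift n q)

instance : NoZeroDivisors (Torus n q) := skew_noZeroDivisors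

variable {n}

/-- The monomial `h_i` of `k[h_1^{±1}, …, h_n^{±1}]`. -/
def lh (k : Type*) [Field k] {n : ℕ} (i : Fin n) (a : ℤ) : Laurent k n :=
  AddMonoidAlgebra.single (Pi.single i a) 1

theorem lh_add (i : Fin n) (a b : ℤ) : lh k i (a + b) = lh k i a * lh k i b := by
  rw [lh, Pi.single_add, lh, lh, AddMonoidAlgebra.single_mul_single, mul_one]

theorem lh_zero (i : Fin n) : lh k i 0 = 1 := by
  rw [lh, Pi.single_zero]; rfl

theorem smul_lh (d : Fin n → ℤ) (i : Fin n) (a : ℤ) :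
    QShift.of n q d • lh k i a = ((q ^ (d i * a) : kˣ) : k) • lh k i a := by
  rw [lh, QShift.smul_single, AddMonoidAlgebra.smul_single]
  simp [QShift.vec, QShift.of, Pi.single_apply]

/-- The inclusion of `k[h_1^{±1}, …, h_n^{±1}]` in the quantum torus. -/
def Torus.ofLaurent : Laurent k n →ₐ[k] Torus n q where
  __ := SkewMonoidAlgebra.singleOneRingHom
  commutes' _ := rfl

theorem Torus.ofLaurent_apply (p : Laurent k n) :
    Torus.ofLaurent q p = SkewMonoidAlgebra.single 1 p := rfl

theorem lh_mul_lh_neg (i : Fin n) (a : ℤ) : lh k i a * lh k i (-a) = 1 := by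
  rw [← lh_add, add_neg_cancel, lh_zero]

/-- The unit `h_i` of the quantum torus. -/
def Torus.h (i : Fin n) : (Torus n q)ˣ where
  val := Torus.ofLaurent q (lh k i 1)
  inv := Torus.ofLaurent q (lh k i (-1))
  val_inv := by rw [← map_mul, lh_mul_lh_neg, map_one]
  inv_val := by rw [← map_mul, mul_comm, lh_mul_lh_neg, map_one]

/-- The image of `x_i` in the quantum torus. -/
def Torus.x (i : Fin n) : Torus n q := SkewMonoidAlgebra.single (QShift.of n q (Pi.single i 1)) 1

/-- The image of `y_i` in the quantum torus. -/
def Torus.y (i : Fin n) : Torus n q :=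
  SkewMonoidAlgebra.single (QShift.of n q (-Pi.single i 1)) (lh k i 1 - 1)

end Torus

/-! ### Ordered products of commuting families -/

section List

variable {M : Type*} [Monoid M]

/-- By induction, `g 0` moves past all later `f i`. This makes the product of the factor maps
multiplicative although the torus is not commutative. -/
theorem prod_ofFn_mul {n : ℕ} (f g : Fin n → M) (hfg : ∀ i j, i ≠ j → Commute (f i) (g j)) :
    (List.ofFn fun i => f i * g i).prod = (List.ofFn f).prod * (List.ofFn g).prod := by
  induction n with
  | zero => simp
  | succ n ih =>
    rw [List.ofFn_succ, List.prod_cons, ih _ _ fun i j hij =>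
      hfg _ _ ((Fin.succ_injective n).ne hij), List.ofFn_succ, List.prod_cons, List.ofFn_succ,
      List.prod_cons]
    have h1 : Commute (List.ofFn fun i : Fin n => f i.succ).prod (g 0) :=
      Commute.list_prod_left _ _ fun z hz => by
        obtain ⟨i, rfl⟩ := (List.mem_ofFn' _ _).1 hz
        exact hfg _ _ (Fin.succ_ne_zero i)
    rw [mul_assoc, mul_assoc, ← mul_assoc (g 0), ← h1.eq, mul_assoc]

theorem prod_ofFn_mulSingle {n : ℕ} (i : Fin n) (b : M) :
    (List.ofFn (Pi.mulSingle (M := fun _ => M) i b)).prod = b := by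
  induction n with
  | zero => exact i.elim0
  | succ n ih =>
    rw [List.ofFn_succ, List.prod_cons]
    refine Fin.cases ?_ (fun i => ?_) i
    · rw [Pi.mulSingle_eq_same]
      convert mul_one b
      apply List.prod_eq_one
      intro z hz
      obtain ⟨j, rfl⟩ := (List.mem_ofFn' _ _).1 hz
      exact Pi.mulSingle_eq_of_ne (Fin.succ_ne_zero j) _
    · rw [Pi.mulSingle_eq_of_ne (Fin.succ_ne_zero i).symm, one_mul]
      convert ih i using 3
      funext j
      by_cases hj : j = i
      · subst hj
        rw [Pi.mulSingle_eq_same, Pi.mulSingle_eq_same]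
      · rw [Pi.mulSingle_eq_of_ne hj, Pi.mulSingle_eq_of_ne ((Fin.succ_injective n).ne hj)]

end List

theorem skew_list_prod_single {R G : Type*} [Ring R] [IsDomain R] [Group G] [MulSemiringAction G R]
    {n : ℕ} (g : Fin n → G) (r : Fin n → R) (hr : ∀ i, r i ≠ 0) :
    ∃ s : R, s ≠ 0 ∧ (List.ofFn fun i => SkewMonoidAlgebra.single (g i) (r i)).prod
      = SkewMonoidAlgebra.single (List.ofFn g).prod s := by
  induction n with
  | zero => exact ⟨1, one_ne_zero, rfl⟩
  | succ n ih =>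
    obtain ⟨s, hs, h1⟩ := ih (fun i => g i.succ) (fun i => r i.succ) fun i => hr _
    refine ⟨r 0 * g 0 • s, mul_ne_zero (hr 0) fun h0 => hs ((smul_eq_zero_iff_eq _).1 h0), ?_⟩
    rw [List.ofFn_succ, List.prod_cons, h1, SkewMonoidAlgebra.single_mul_single, List.ofFn_succ,
      List.prod_cons]

/-! ### The map from the tensor power to the quantum torus -/

section

variable {k : Type*} [Field k] (q : kˣ) {B : Type*} [Ring B] [Algebra k B]

theorem A₁.coe_T (m : ℤ) : (GWA.coe _ _ (LaurentPolynomial.T m) : A₁ k 1 q) = ↑(A₁.h q ^ m) := by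
  have h1 : GWA.coeHom (sigma₁ k q) (LaurentPolynomial.T 1 ^ 1 - 1) = laurentLift (A₁.h q) :=
    laurent_hom_ext (by rw [laurentLift_T, zpow_one]; rfl)
  rw [← laurentLift_T (k := k), ← h1]
  rfl

theorem A₁.mem_subalgebra (S : Subalgebra k (A₁ k 1 q)) (hh : ↑(A₁.h q) ∈ S)
    (hh' : ↑(A₁.h q)⁻¹ ∈ S) (hx : A₁.x q ∈ S) (hy : A₁.y q ∈ S) (b : A₁ k 1 q) : b ∈ S := by
  refine GWA.mem_subalgebra _ _ S (fun r => ?_) hx hy b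
  induction r using AddMonoidAlgebra.induction_linear with
  | zero => exact (congrArg (· ∈ S) (map_zero (GWA.coeHom _ _))).mpr S.zero_mem
  | add p p' hp hp' =>
    exact (congrArg (· ∈ S) (map_add (GWA.coeHom _ _) p p')).mpr (S.add_mem hp hp')
  | single m d =>
    have h0 : AddMonoidAlgebra.single m d = d • LaurentPolynomial.T (R := k) m := by
      rw [LaurentPolynomial.T, AddMonoidAlgebra.smul_single, smul_eq_mul, mul_one]
    rw [h0, A₁.coe_smul, A₁.coe_T]
    refine S.smul_mem ?_ d
    cases m with
    | ofNat m =>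
      rw [Int.ofNat_eq_natCast, zpow_natCast, Units.val_pow_eq_pow_val]
      exact S.pow_mem hh m
    | negSucc m =>
      rw [zpow_negSucc, ← inv_pow, Units.val_pow_eq_pow_val]
      exact S.pow_mem hh' _

/-- The elements whose image commutes with `b` form a subalgebra, and it contains `h⁻¹` along with
`h`. -/
theorem A₁.commute_of_generators (f : A₁ k 1 q →ₐ[k] B) (b : B) (hh : Commute b (f (A₁.h q)))
    (hx : Commute b (f (A₁.x q))) (hy : Commute b (f (A₁.y q))) (z : A₁ k 1 q) :
    Commute b (f z) := by
  have h1 : z ∈ (Subalgebra.centralizer k {b}).comap f := by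
    refine A₁.mem_subalgebra q _ ?_ ?_ ?_ ?_ z
    · simpa [Subalgebra.mem_centralizer_iff] using hh.eq
    · have h2 : Commute b (Units.map (f : A₁ k 1 q →* B) (A₁.h q) : B) := hh
      have h3 := h2.units_inv_right
      rw [← map_inv] at h3
      simpa [Subalgebra.mem_centralizer_iff] using h3.eq
    · simpa [Subalgebra.mem_centralizer_iff] using hx.eq
    · simpa [Subalgebra.mem_centralizer_iff] using hy.eq
  exact (Subalgebra.mem_centralizer_iff k).1 h1 b rfl

variable {n : ℕ}

theorem smul_lh_single (j i : Fin n) (a b : ℤ) :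
    QShift.of n q (Pi.single j b) • lh k i a
      = (if i = j then ((q ^ (b * a) : kˣ) : k) else 1) • lh k i a := by
  rw [smul_lh]
  split_ifs with hij
  · rw [hij, Pi.single_eq_same]
  · rw [Pi.single_eq_of_ne hij, zero_mul, zpow_zero, Units.val_one]

theorem Torus.x_mul_ofLaurent (i : Fin n) (p : Laurent k n) :
    Torus.x q i * Torus.ofLaurent q p = Torus.ofLaurent q (sigma n q i p) * Torus.x q i := by
  rw [Torus.x, Torus.ofLaurent_apply, Torus.ofLaurent_apply, SkewMonoidAlgebra.single_mul_single,
    SkewMonoidAlgebra.single_mul_single, sigma_eq_smul, mul_one, one_mul, one_mul, smul_one, mul_one]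

theorem sigma_lh (i : Fin n) (a : ℤ) : sigma n q i (lh k i a) = ((q ^ a : kˣ) : k) • lh k i a := by
  rw [sigma_eq_smul, smul_lh_single, if_pos rfl, one_mul]

theorem Torus.x_mul_y (i : Fin n) :
    Torus.x q i * Torus.y q i = Torus.ofLaurent q (sigma n q i (lh k i 1 - 1)) := by
  rw [Torus.x, Torus.y, SkewMonoidAlgebra.single_mul_single, sigma_eq_smul, one_mul,
    ← QShift.of_add, add_neg_cancel, QShift.of_zero, Torus.ofLaurent_apply]

theorem Torus.y_mul_x (i : Fin n) :
    Torus.y q i * Torus.x q i = Torus.ofLaurent q (lh k i 1 - 1) := by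
  rw [Torus.x, Torus.y, SkewMonoidAlgebra.single_mul_single, smul_one, mul_one,
    ← QShift.of_add, neg_add_cancel, QShift.of_zero, Torus.ofLaurent_apply]

/-- The `i`-th tensor factor in the quantum torus. -/
def Torus.factor (i : Fin n) : A₁ k 1 q →ₐ[k] Torus n q :=
  A₁.lift q (Torus.h q i) (Torus.x q i) (Torus.y q i)
    (by
      refine (Torus.x_mul_ofLaurent q i _).trans ?_
      rw [sigma_lh, zpow_one, map_smul, smul_mul_assoc]
      rfl)
    (by
      change Torus.y q i * Torus.ofLaurent q (lh k i 1) =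
        _ • (Torus.ofLaurent q (lh k i 1) * Torus.y q i)
      rw [Torus.y, Torus.ofLaurent_apply, SkewMonoidAlgebra.single_mul_single,
        SkewMonoidAlgebra.single_mul_single, ← Pi.single_neg, smul_lh_single, if_pos rfl,
        mul_smul_comm, SkewMonoidAlgebra.smul_single, mul_one, mul_one, one_smul, one_mul,
        zpow_neg_one, Units.val_inv_eq_inv_val, mul_comm])
    (by
      rw [Torus.x_mul_y, map_sub, sigma_lh, zpow_one, map_one, map_sub, map_one, map_smul]
      rfl)
    (by
      rw [Torus.y_mul_x, map_sub, map_one]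
      rfl)

theorem Torus.factor_h (i : Fin n) : Torus.factor q i (A₁.h q) = Torus.ofLaurent q (lh k i 1) :=
  A₁.lift_h ..

theorem Torus.factor_x (i : Fin n) : Torus.factor q i (A₁.x q) = Torus.x q i := A₁.lift_x ..

theorem Torus.factor_y (i : Fin n) : Torus.factor q i (A₁.y q) = Torus.y q i := A₁.lift_y ..

theorem Torus.factor_coe_T (i : Fin n) (m : ℤ) :
    Torus.factor q i (GWA.coe _ _ (LaurentPolynomial.T m)) = Torus.ofLaurent q (lh k i m) := by
  have h1 : (Torus.factor q i).comp (GWA.coeHom (sigma₁ k q) (LaurentPolynomial.T 1 ^ 1 - 1))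
      = (Torus.ofLaurent q).comp (AddMonoidAlgebra.lift k (Laurent k n) ℤ
        { toFun := fun m => lh k i m.toAdd
          map_one' := lh_zero i
          map_mul' := fun a b => lh_add i _ _ }) := by
    refine laurent_hom_ext ?_
    rw [AlgHom.comp_apply, AlgHom.comp_apply]
    refine (Torus.factor_h q i).trans (congrArg _ ?_)
    refine Eq.trans ?_ (AddMonoidAlgebra.lift_single _ _ _).symm
    rw [one_smul]
    rfl
  refine (DFunLike.congr_fun h1 _).trans (congrArg (Torus.ofLaurent q) ?_)
  refine (AddMonoidAlgebra.lift_single _ _ _).trans ?_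
  rw [one_smul]
  rfl

theorem Torus.commute_generators {i j : Fin n} {d d' : ℤ} {p p' : Laurent k n}
    (hp : QShift.of n q (Pi.single j d') • p = p) (hp' : QShift.of n q (Pi.single i d) • p' = p') :
    Commute (SkewMonoidAlgebra.single (QShift.of n q (Pi.single i d)) p : Torus n q)
      (SkewMonoidAlgebra.single (QShift.of n q (Pi.single j d')) p') := by
  rw [Commute, SemiconjBy, SkewMonoidAlgebra.single_mul_single, SkewMonoidAlgebra.single_mul_single,
    hp, hp', mul_comm, mul_comm p]

/-- The generators of the `i`-th factor have degrees along the `i`-th axis, and their coefficients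
involve only `h_i`, so shifts in the other directions fix them. -/
theorem Torus.factor_commute {i j : Fin n} (hij : i ≠ j) (a b : A₁ k 1 q) :
    Commute (Torus.factor q i a) (Torus.factor q j b) := by
  have key : ∀ i : Fin n, ∃ dh dx dy : ℤ, ∃ ph px py : Laurent k n,
      Torus.factor q i (A₁.h q) = SkewMonoidAlgebra.single (QShift.of n q (Pi.single i dh)) ph ∧
      Torus.factor q i (A₁.x q) = SkewMonoidAlgebra.single (QShift.of n q (Pi.single i dx)) px ∧
      Torus.factor q i (A₁.y q) = SkewMonoidAlgebra.single (QShift.of n q (Pi.single i dy)) py ∧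
      ∀ j, i ≠ j → ∀ d : ℤ, QShift.of n q (Pi.single j d) • ph = ph ∧
        QShift.of n q (Pi.single j d) • px = px ∧ QShift.of n q (Pi.single j d) • py = py := by
    intro i
    refine ⟨0, 1, -1, lh k i 1, 1, lh k i 1 - 1, ?_, Torus.factor_x q i, ?_, ?_⟩
    · rw [Torus.factor_h, Torus.ofLaurent_apply, Pi.single_zero, QShift.of_zero]
    · rw [Torus.factor_y, Torus.y, Pi.single_neg]
    · intro j hij d
      refine ⟨?_, smul_one _, ?_⟩
      · rw [smul_lh_single, if_neg hij, one_smul]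
      · rw [smul_sub, smul_one, smul_lh_single, if_neg hij, one_smul]
  obtain ⟨dh, dx, dy, ph, px, py, h1, h2, h3, h4⟩ := key i
  obtain ⟨dh', dx', dy', ph', px', py', h1', h2', h3', h4'⟩ := key j
  have gen : ∀ d (p : Laurent k n), (∀ d', QShift.of n q (Pi.single j d') • p = p) → ∀ b,
      Commute (SkewMonoidAlgebra.single (QShift.of n q (Pi.single i d)) p : Torus n q)
        (Torus.factor q j b) := by
    intro d p hp b
    refine A₁.commute_of_generators q _ _ ?_ ?_ ?_ b
    · rw [h1']
      exact Torus.commute_generators q (hp _) (h4' i hij.symm _).1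
    · rw [h2']
      exact Torus.commute_generators q (hp _) (h4' i hij.symm _).2.1
    · rw [h3']
      exact Torus.commute_generators q (hp _) (h4' i hij.symm _).2.2
  refine (A₁.commute_of_generators q _ _ ?_ ?_ ?_ a).symm
  · rw [h1]
    exact (gen _ _ (fun d => (h4 j hij d).1) b).symm
  · rw [h2]
    exact (gen _ _ (fun d => (h4 j hij d).2.1) b).symm
  · rw [h3]
    exact (gen _ _ (fun d => (h4 j hij d).2.2) b).symm

variable (n) in
/-- The homomorphism from the tensor power of `A(1, q)` to the quantum torus. -/
def toTorus : A k n 1 q →ₐ[k] Torus n q :=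
  PiTensorProduct.liftAlgHom
    ((MultilinearMap.mkPiAlgebraFin k n (Torus n q)).compLinearMap
      fun i => (Torus.factor q i).toLinearMap)
    (by
      rw [MultilinearMap.compLinearMap_apply, MultilinearMap.mkPiAlgebraFin_apply]
      apply List.prod_eq_one
      intro z hz
      obtain ⟨j, rfl⟩ := (List.mem_ofFn' _ _).1 hz
      exact map_one (Torus.factor q j))
    (by
      intro a b
      simp only [MultilinearMap.compLinearMap_apply, MultilinearMap.mkPiAlgebraFin_apply,
        AlgHom.toLinearMap_apply, Pi.mul_apply, map_mul]
      exact prod_ofFn_mul _ _ fun i j hij => Torus.factor_commute q hij _ _)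

theorem toTorus_tprod (a : Fin n → A₁ k 1 q) : toTorus q n (PiTensorProduct.tprod k a)
    = (List.ofFn fun i => Torus.factor q i (a i)).prod := by
  refine (PiTensorProduct.lift.tprod _).trans ?_
  rw [MultilinearMap.compLinearMap_apply, MultilinearMap.mkPiAlgebraFin_apply]
  rfl

theorem toTorus_single (i : Fin n) (b : A₁ k 1 q) :
    toTorus q n (PiTensorProduct.singleAlgHom (R := k) (A := fun _ : Fin n => A₁ k 1 q) i b)
      = Torus.factor q i b := by
  refine (toTorus_tprod q _).trans ?_
  rw [← prod_ofFn_mulSingle i (Torus.factor q i b)]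
  congr 2
  funext j
  by_cases hj : j = i
  · subst hj
    simp
  · simp [Pi.mulSingle_eq_of_ne hj]

theorem toTorus_h (i : Fin n) : toTorus q n (h n 1 q i) = Torus.ofLaurent q (lh k i 1) :=
  (toTorus_single q i _).trans (Torus.factor_h q i)

theorem toTorus_x (i : Fin n) : toTorus q n (x n 1 q i) = Torus.x q i :=
  (toTorus_single q i _).trans (Torus.factor_x q i)

theorem toTorus_y (i : Fin n) : toTorus q n (y n 1 q i) = Torus.y q i :=
  (toTorus_single q i _).trans (Torus.factor_y q i)

theorem prod_lh (m : Fin n → ℤ) :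
    ∏ i, lh k i (m i) = AddMonoidAlgebra.single m 1 := by
  have h1 : ∀ s : Finset (Fin n), ∏ i ∈ s, lh k i (m i)
      = AddMonoidAlgebra.single (∑ i ∈ s, Pi.single i (m i)) 1 := by
    intro s
    induction s using Finset.induction with
    | empty => rfl
    | insert a s ha ih =>
      rw [Finset.prod_insert ha, ih, Finset.sum_insert ha, lh, AddMonoidAlgebra.single_mul_single,
        mul_one]
  rw [h1, Finset.univ_sum_single]

theorem ofLaurent_single (m : Fin n → ℤ) (c : k) :
    ofLaurent n 1 q (AddMonoidAlgebra.single m c) = c • PiTensorProduct.tprod k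
        fun i => GWA.coe (sigma₁ k q) _ (LaurentPolynomial.T (m i)) :=
  AddMonoidAlgebra.lift_single _ _ _

theorem toTorus_ofLaurent (p : Laurent k n) :
    toTorus q n (ofLaurent n 1 q p) = Torus.ofLaurent q p := by
  induction p using AddMonoidAlgebra.induction_linear with
  | zero => simp
  | add p p' hp hp' => rw [map_add, map_add, map_add, hp, hp']
  | single m c =>
    have h0 : (AddMonoidAlgebra.single m c : Laurent k n) = c • AddMonoidAlgebra.single m 1 := by
      rw [AddMonoidAlgebra.smul_single, smul_eq_mul, mul_one]
    rw [ofLaurent_single, map_smul, toTorus_tprod, h0, map_smul, ← prod_lh]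
    congr 1
    simp_rw [Torus.factor_coe_T]
    rw [← List.prod_ofFn, map_list_prod, List.map_ofFn]
    rfl

end

/-! ### Expansion in monomials and injectivity of the embedding -/

section Expansion

variable {k : Type*} [Field k] (q : kˣ) {n : ℕ}

/-- The monomials `x^a`, for `a ≥ 0`, and `y^{-a}`, for `a < 0`. -/
def A₁.z : ℤ → A₁ k 1 q
  | Int.ofNat m => A₁.x q ^ m
  | Int.negSucc m => A₁.y q ^ (m + 1)

theorem A₁.z_natCast (m : ℕ) : A₁.z q m = A₁.x q ^ m := rfl

theorem A₁.z_neg_natCast (m : ℕ) : A₁.z q (-m) = A₁.y q ^ m := by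
  cases m with
  | zero => exact (pow_zero _).trans (pow_zero _).symm
  | succ m => rfl

theorem A₁.z_zero : A₁.z q 0 = 1 := pow_zero _

theorem A₁.z_mul_x {a : ℤ} (ha : 0 ≤ a) : A₁.z q a * A₁.x q = A₁.z q (a + 1) := by
  lift a to ℕ using ha
  rw [A₁.z_natCast, ← pow_succ, ← A₁.z_natCast, Nat.cast_succ]

theorem A₁.z_mul_y {a : ℤ} (ha : a ≤ 0) : A₁.z q a * A₁.y q = A₁.z q (a - 1) := by
  obtain ⟨m, rfl⟩ := Int.exists_eq_neg_ofNat ha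
  rw [A₁.z_neg_natCast, ← pow_succ, ← A₁.z_neg_natCast, Nat.cast_succ, neg_add, sub_eq_add_neg]

/-- For `a < 0` the new `x` meets a `y` and `xy = σ(h - 1)`; otherwise nothing cancels and the
coefficient is `1`. -/
theorem A₁.x_mul_z (a : ℤ) : ∃ r : LaurentPolynomial k,
    A₁.x q * A₁.z q a = GWA.coe _ _ r * A₁.z q (a + 1) := by
  rcases le_or_gt 0 a with ha | ha
  · lift a to ℕ using ha
    refine ⟨1, ?_⟩
    rw [A₁.z_natCast, ← pow_succ', ← A₁.z_natCast, Nat.cast_succ, GWA.coe_one, one_mul]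
  · obtain ⟨m, rfl⟩ := Int.eq_negSucc_of_lt_zero ha
    refine ⟨sigma₁ k q (LaurentPolynomial.T 1 ^ 1 - 1), ?_⟩
    rw [show Int.negSucc m + 1 = -(m : ℤ) by omega, A₁.z_neg_natCast]
    change A₁.x q * A₁.y q ^ (m + 1) = _
    exact (congrArg (_ * ·) (pow_succ' (A₁.y q) m)).trans ((mul_assoc _ _ _).symm.trans
      (congrArg (· * _) (GWA.x_mul_y _ _)))

theorem A₁.y_mul_z (a : ℤ) : ∃ r : LaurentPolynomial k,
    A₁.y q * A₁.z q a = GWA.coe _ _ r * A₁.z q (a - 1) := by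
  rcases le_or_gt a 0 with ha | ha
  · obtain ⟨m, rfl⟩ := Int.exists_eq_neg_ofNat ha
    refine ⟨1, ?_⟩
    rw [A₁.z_neg_natCast, ← pow_succ', ← A₁.z_neg_natCast, Nat.cast_succ, GWA.coe_one, one_mul,
      neg_add, sub_eq_add_neg]
  · obtain ⟨m, rfl⟩ := Int.eq_succ_of_zero_lt ha
    refine ⟨LaurentPolynomial.T 1 ^ 1 - 1, ?_⟩
    rw [add_sub_cancel_right, ← Nat.cast_succ, A₁.z_natCast, A₁.z_natCast]
    exact (congrArg (_ * ·) (pow_succ' (A₁.x q) m)).trans ((mul_assoc _ _ _).symm.trans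
      (congrArg (· * _) (GWA.y_mul_x _ _)))

theorem A₁.x_mul_coe_T (m : ℤ) : A₁.x q * GWA.coe _ _ (LaurentPolynomial.T m)
    = algebraMap k _ ((q ^ m : kˣ) : k) * GWA.coe _ _ (LaurentPolynomial.T m) * A₁.x q := by
  refine (GWA.x_mul_coe _ _ _).trans ?_
  rw [sigma₁_T, A₁.coe_smul, Algebra.smul_def]
  rfl

theorem A₁.y_mul_coe_T (m : ℤ) : A₁.y q * GWA.coe _ _ (LaurentPolynomial.T m)
    = algebraMap k _ ((q⁻¹ ^ m : kˣ) : k) * GWA.coe _ _ (LaurentPolynomial.T m) * A₁.y q := by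
  refine (GWA.y_mul_coe _ _ _).trans ?_
  rw [sigma₁_symm_T, A₁.coe_smul, Algebra.smul_def]
  rfl

/-- The inclusion of the `i`-th tensor factor. -/
abbrev single (i : Fin n) : A₁ k 1 q →ₐ[k] A k n 1 q :=
  PiTensorProduct.singleAlgHom (R := k) (A := fun _ : Fin n => A₁ k 1 q) i

theorem single_eq_tprod (i : Fin n) (b : A₁ k 1 q) :
    single q i b = PiTensorProduct.tprod k (Pi.mulSingle (M := fun _ => A₁ k 1 q) i b) := rfl

theorem ofLaurent_lh (i : Fin n) (m : ℤ) :
    ofLaurent n 1 q (lh k i m) = single q i (GWA.coe _ _ (LaurentPolynomial.T m)) := by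
  rw [lh, ofLaurent_single, one_smul, single_eq_tprod]
  congr 1
  funext j
  by_cases hj : j = i
  · subst hj
    rw [Pi.single_eq_same, Pi.mulSingle_eq_same]
  · rw [Pi.single_eq_of_ne hj, Pi.mulSingle_eq_of_ne hj, LaurentPolynomial.T_zero]
    exact GWA.coe_one _ _

theorem ofLaurent_lh_one (i : Fin n) : ofLaurent n 1 q (lh k i 1) = h n 1 q i := ofLaurent_lh q i 1

theorem single_coe_mem_range (i : Fin n) (r : LaurentPolynomial k) :
    ∃ p, single q i (GWA.coe _ _ r) = ofLaurent n 1 q p := by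
  induction r using AddMonoidAlgebra.induction_linear with
  | zero =>
    exact ⟨0, (congrArg (single q i) (map_zero (GWA.coeHom _ _))).trans
      ((map_zero _).trans (map_zero _).symm)⟩
  | add p p' hp hp' =>
    obtain ⟨r, hr⟩ := hp
    obtain ⟨r', hr'⟩ := hp'
    refine ⟨r + r', ?_⟩
    rw [map_add, ← hr, ← hr', ← map_add]
    exact congrArg (single q i) (map_add (GWA.coeHom _ _) p p')
  | single m d =>
    have h0 : AddMonoidAlgebra.single m d = d • LaurentPolynomial.T (R := k) m := by
      rw [LaurentPolynomial.T, AddMonoidAlgebra.smul_single, smul_eq_mul, mul_one]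
    exact ⟨d • lh k i m, by rw [h0, A₁.coe_smul, map_smul, map_smul, ofLaurent_lh]⟩

/-- Only the `i`-th tensor slot is affected, and there a monomial is scaled. The unit `c` is `q` for
`b = x` and `q⁻¹` for `b = y`. -/
theorem single_mul_ofLaurent (i : Fin n) (b : A₁ k 1 q) (c : kˣ)
    (hb : ∀ m, b * GWA.coe _ _ (LaurentPolynomial.T m)
      = algebraMap k _ ((c ^ m : kˣ) : k) * GWA.coe _ _ (LaurentPolynomial.T m) * b)
    (p : Laurent k n) :
    ∃ p', single q i b * ofLaurent n 1 q p = ofLaurent n 1 q p' * single q i b := by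
  induction p using AddMonoidAlgebra.induction_linear with
  | zero => exact ⟨0, by simp⟩
  | add p p' hp hp' =>
    obtain ⟨r, hr⟩ := hp
    obtain ⟨r', hr'⟩ := hp'
    exact ⟨r + r', by rw [map_add, mul_add, hr, hr', map_add, add_mul]⟩
  | single m d =>
    refine ⟨((c ^ m i : kˣ) : k) • AddMonoidAlgebra.single m d, ?_⟩
    rw [map_smul, ofLaurent_single, mul_smul_comm, smul_comm, smul_mul_assoc]
    congr 1
    rw [Algebra.smul_def, PiTensorProduct.algebraMap_apply _ i, single_eq_tprod,
      PiTensorProduct.tprod_mul_tprod, PiTensorProduct.tprod_mul_tprod,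
      PiTensorProduct.tprod_mul_tprod]
    congr 1
    funext j
    rw [Pi.mul_apply, Pi.mul_apply, Pi.mul_apply]
    by_cases hj : j = i
    · subst hj
      rw [Pi.mulSingle_eq_same, Pi.mulSingle_eq_same]
      exact hb _
    · rw [Pi.mulSingle_eq_of_ne hj, Pi.mulSingle_eq_of_ne hj, one_mul, mul_one]

/-- The monomial in the `x_i` and `y_i` of degree `d`. -/
def z (d : Fin n → ℤ) : A k n 1 q := PiTensorProduct.tprod k fun i => A₁.z q (d i)

theorem z_zero : z q (0 : Fin n → ℤ) = 1 := by
  rw [z, PiTensorProduct.one_def]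
  congr 1
  funext i
  exact A₁.z_zero q

theorem single_mul_z (i : Fin n) (b : A₁ k 1 q) (d : Fin n → ℤ) (a : ℤ) (r : LaurentPolynomial k)
    (hb : b * A₁.z q (d i) = GWA.coe _ _ r * A₁.z q (d i + a)) :
    ∃ p, single q i b * z q d = ofLaurent n 1 q p * z q (d + Pi.single i a) := by
  obtain ⟨p, hp⟩ := single_coe_mem_range q i r
  refine ⟨p, ?_⟩
  rw [← hp, single_eq_tprod, single_eq_tprod, z, z, PiTensorProduct.tprod_mul_tprod,
    PiTensorProduct.tprod_mul_tprod]
  congr 1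
  funext j
  rw [Pi.mul_apply, Pi.mul_apply, Pi.add_apply]
  by_cases hj : j = i
  · subst hj
    rw [Pi.mulSingle_eq_same, Pi.mulSingle_eq_same, Pi.single_eq_same]
    exact hb
  · rw [Pi.mulSingle_eq_of_ne hj, Pi.mulSingle_eq_of_ne hj, Pi.single_eq_of_ne hj, add_zero]

theorem z_mul_single (i : Fin n) (b : A₁ k 1 q) (d : Fin n → ℤ) (a : ℤ)
    (hb : A₁.z q (d i) * b = A₁.z q (d i + a)) :
    z q d * single q i b = z q (d + Pi.single i a) := by
  rw [single_eq_tprod, z, z, PiTensorProduct.tprod_mul_tprod]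
  congr 1
  funext j
  rw [Pi.mul_apply, Pi.add_apply]
  by_cases hj : j = i
  · subst hj
    rw [Pi.mulSingle_eq_same, Pi.single_eq_same]
    exact hb
  · rw [Pi.mulSingle_eq_of_ne hj, Pi.single_eq_of_ne hj, add_zero, mul_one]

/-- Here the last factor of the `j`-th slot is split off without any Laurent coefficient, since no
`xy` or `yx` is contracted. -/
theorem z_eq_mul_x {d : Fin n → ℤ} {j : Fin n} (hd : 0 < d j) :
    z q d = z q (d - Pi.single j 1) * x n 1 q j := by
  refine Eq.trans ?_ (z_mul_single q j (A₁.x q) _ 1 ?_).symm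
  · rw [sub_add_cancel]
  · refine A₁.z_mul_x q ?_
    rw [Pi.sub_apply, Pi.single_eq_same]
    omega

theorem z_eq_mul_y {d : Fin n → ℤ} {j : Fin n} (hd : d j < 0) :
    z q d = z q (d + Pi.single j 1) * y n 1 q j := by
  refine Eq.trans ?_ (z_mul_single q j (A₁.y q) _ (-1) ?_).symm
  · rw [Pi.single_neg, add_neg_cancel_right]
  · refine A₁.z_mul_y q ?_
    rw [Pi.add_apply, Pi.single_eq_same]
    omega

variable (n) in
/-- The span of the `p z^d` with `p` a Laurent polynomial. -/
def zSpan : Submodule k (A k n 1 q) :=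
  Submodule.span k {w | ∃ p d, w = ofLaurent n 1 q p * z q d}

/-- The `b` whose left multiplication preserves the span form a subalgebra, so it is enough to treat
the generators of one tensor factor. -/
theorem single_mul_mem_zSpan (i : Fin n) (b : A₁ k 1 q) {w : A k n 1 q} (hw : w ∈ zSpan q n) :
    single q i b * w ∈ zSpan q n := by
  let S : Subalgebra k (A₁ k 1 q) :=
    { carrier := {b | ∀ w ∈ zSpan q n, single q i b * w ∈ zSpan q n}
      mul_mem' := fun {a b} ha hb w hw => by
        rw [map_mul, mul_assoc]
        exact ha _ (hb _ hw)
      add_mem' := fun {a b} ha hb w hw => by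
        rw [map_add, add_mul]
        exact add_mem (ha _ hw) (hb _ hw)
      algebraMap_mem' := fun c w hw => by
        rw [AlgHom.commutes, ← Algebra.smul_def]
        exact Submodule.smul_mem _ _ hw }
  have ext : ∀ b, (∀ p d, single q i b * (ofLaurent n 1 q p * z q d) ∈ zSpan q n) → b ∈ S := by
    intro b hb w hw
    induction hw using Submodule.span_induction with
    | mem w hw =>
      obtain ⟨p, d, rfl⟩ := hw
      exact hb p d
    | zero => rw [mul_zero]; exact zero_mem _
    | add w w' _ _ h1 h2 => rw [mul_add]; exact add_mem h1 h2
    | smul c w _ h1 => rw [mul_smul_comm]; exact Submodule.smul_mem _ _ h1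
  refine GWA.mem_subalgebra _ _ S ?_ ?_ ?_ b w hw
  · intro r
    apply ext
    intro p d
    obtain ⟨p', hp'⟩ := single_coe_mem_range q i r
    rw [hp', ← mul_assoc, ← map_mul]
    exact Submodule.subset_span ⟨_, _, rfl⟩
  · apply ext
    intro p d
    obtain ⟨p', hp'⟩ := single_mul_ofLaurent q i (A₁.x q) q (A₁.x_mul_coe_T q) p
    obtain ⟨r, hr⟩ := A₁.x_mul_z q (d i)
    obtain ⟨p'', hp''⟩ := single_mul_z q i (A₁.x q) d 1 r hr
    refine Submodule.subset_span ⟨p' * p'', d + Pi.single i 1, ?_⟩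
    rw [map_mul, mul_assoc, ← hp'', ← mul_assoc, ← mul_assoc, ← hp']
    rfl
  · apply ext
    intro p d
    obtain ⟨p', hp'⟩ := single_mul_ofLaurent q i (A₁.y q) q⁻¹ (A₁.y_mul_coe_T q) p
    obtain ⟨r, hr⟩ := A₁.y_mul_z q (d i)
    obtain ⟨p'', hp''⟩ := single_mul_z q i (A₁.y q) d (-1) r hr
    refine Submodule.subset_span ⟨p' * p'', d + Pi.single i (-1), ?_⟩
    rw [map_mul, mul_assoc, ← hp'', ← mul_assoc, ← mul_assoc, ← hp']
    rfl

/-- A pure tensor arises from `1` by left multiplications, filling one slot at a time. -/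
theorem tprod_mem_zSpan (a : Fin n → A₁ k 1 q) : PiTensorProduct.tprod k a ∈ zSpan q n := by
  classical
  have key : ∀ s : Finset (Fin n),
      PiTensorProduct.tprod k (fun i => if i ∈ s then a i else 1) ∈ zSpan q n := by
    intro s
    induction s using Finset.induction with
    | empty =>
      refine Submodule.subset_span ⟨1, 0, ?_⟩
      rw [map_one, z_zero, one_mul, PiTensorProduct.one_def]
      rfl
    | insert j s hj ih =>
      convert single_mul_mem_zSpan q j (a j) ih using 1
      rw [single_eq_tprod, PiTensorProduct.tprod_mul_tprod]
      congr 1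
      funext i
      rw [Pi.mul_apply]
      by_cases hij : i = j
      · subst hij
        rw [if_pos (Finset.mem_insert_self _ _), if_neg hj, mul_one, Pi.mulSingle_eq_same]
      · rw [Pi.mulSingle_eq_of_ne hij, one_mul]
        simp [hij]
  simpa using key Finset.univ

theorem zSpan_eq_top : zSpan q n = ⊤ := by
  rw [eq_top_iff, ← PiTensorProduct.span_tprod_eq_top, Submodule.span_le]
  rintro _ ⟨a, rfl⟩
  exact tprod_mem_zSpan q a

theorem exists_expansion (w : A k n 1 q) : ∃ f : (Fin n → ℤ) →₀ Laurent k n,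
    w = f.sum fun d p => ofLaurent n 1 q p * z q d := by
  have hw : w ∈ zSpan q n := by rw [zSpan_eq_top]; trivial
  induction hw using Submodule.span_induction with
  | mem w hw =>
    obtain ⟨p, d, rfl⟩ := hw
    exact ⟨Finsupp.single d p, by rw [Finsupp.sum_single_index (by simp)]⟩
  | zero => exact ⟨0, by simp⟩
  | add w w' _ _ h1 h2 =>
    obtain ⟨f, rfl⟩ := h1
    obtain ⟨f', rfl⟩ := h2
    exact ⟨f + f', by rw [Finsupp.sum_add_index' (by simp) (by simp [add_mul])]⟩
  | smul c w _ h1 =>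
    obtain ⟨f, rfl⟩ := h1
    refine ⟨c • f, ?_⟩
    rw [Finsupp.sum_smul_index' (by simp), Finsupp.smul_sum]
    simp only [map_smul, smul_mul_assoc]

theorem lh_sub_one_ne_zero (i : Fin n) : lh k i 1 - 1 ≠ 0 := by
  rw [sub_ne_zero, lh, AddMonoidAlgebra.one_def]
  intro h1
  have h2 := congrArg (fun p : Laurent k n => p.coeff 0) h1
  simp [AddMonoidAlgebra.coeff_single] at h2

theorem factor_z (i : Fin n) (a : ℤ) : ∃ s : Laurent k n, s ≠ 0 ∧ Torus.factor q i (A₁.z q a)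
    = SkewMonoidAlgebra.single (QShift.of n q (Pi.single i a)) s := by
  have mul : ∀ (a b : ℤ) (s t : Laurent k n), s ≠ 0 → t ≠ 0 → ∃ u : Laurent k n, u ≠ 0 ∧
      (SkewMonoidAlgebra.single (QShift.of n q (Pi.single i a)) s *
        SkewMonoidAlgebra.single (QShift.of n q (Pi.single i b)) t : Torus n q)
        = SkewMonoidAlgebra.single (QShift.of n q (Pi.single i (a + b))) u := by
    intro a b s t hs ht
    refine ⟨s * QShift.of n q (Pi.single i a) • t,
      mul_ne_zero hs fun h0 => ht ((smul_eq_zero_iff_eq _).1 h0), ?_⟩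
    rw [SkewMonoidAlgebra.single_mul_single, ← QShift.of_add, ← Pi.single_add]
  induction a using Int.induction_on with
  | zero =>
    refine ⟨1, one_ne_zero, ?_⟩
    rw [A₁.z_zero, map_one, Pi.single_zero]
    rfl
  | succ a ih =>
    obtain ⟨s, hs, h1⟩ := ih
    rw [← A₁.z_mul_x q (by omega), map_mul, h1, Torus.factor_x]
    exact mul _ _ _ _ hs one_ne_zero
  | pred a ih =>
    obtain ⟨s, hs, h1⟩ := ih
    rw [← A₁.z_mul_y q (by omega), map_mul, h1, Torus.factor_y, Torus.y, ← Pi.single_neg]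
    exact mul _ _ _ _ hs (lh_sub_one_ne_zero i)

theorem prod_of (d : Fin n → ℤ) :
    (List.ofFn fun i => QShift.of n q (Pi.single i (d i))).prod = QShift.of n q d := by
  have h1 : ∀ s : Finset (Fin n), ∏ i ∈ s, QShift.of n q (Pi.single i (d i))
      = QShift.of n q (∑ i ∈ s, Pi.single i (d i)) := by
    intro s
    induction s using Finset.induction with
    | empty => rfl
    | insert a s ha ih => rw [Finset.prod_insert ha, ih, Finset.sum_insert ha, QShift.of_add]
  rw [List.prod_ofFn, h1, Finset.univ_sum_single]

/-- Each slot contributes a homogeneous element with nonzero coefficient, and such coefficients stay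
nonzero under shifts and products. -/
theorem toTorus_z (d : Fin n → ℤ) : ∃ s : Laurent k n, s ≠ 0 ∧
    toTorus q n (z q d) = SkewMonoidAlgebra.single (QShift.of n q d) s := by
  choose s hs h1 using fun i => factor_z q i (d i)
  obtain ⟨t, ht, h2⟩ := skew_list_prod_single (fun i => QShift.of n q (Pi.single i (d i))) s hs
  refine ⟨t, ht, ?_⟩
  rw [z, toTorus_tprod, ← prod_of, ← h2]
  simp_rw [h1]

/-- The coefficient of `z^d` in the quantum torus. -/
def zCoeff (d : Fin n → ℤ) : Laurent k n := (toTorus_z q d).choose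

theorem zCoeff_ne_zero (d : Fin n → ℤ) : zCoeff q d ≠ 0 := (toTorus_z q d).choose_spec.1

theorem toTorus_z_eq (d : Fin n → ℤ) :
    toTorus q n (z q d) = SkewMonoidAlgebra.single (QShift.of n q d) (zCoeff q d) :=
  (toTorus_z q d).choose_spec.2

theorem toTorus_ofLaurent_mul_z (p : Laurent k n) (d : Fin n → ℤ) :
    toTorus q n (ofLaurent n 1 q p * z q d)
      = SkewMonoidAlgebra.single (QShift.of n q d) (p * zCoeff q d) := by
  rw [map_mul, toTorus_ofLaurent, toTorus_z_eq, Torus.ofLaurent_apply,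
    SkewMonoidAlgebra.single_mul_single, one_smul, one_mul]

theorem coeff_toTorus_sum (f : (Fin n → ℤ) →₀ Laurent k n) (d : Fin n → ℤ) :
    (toTorus q n (f.sum fun d p => ofLaurent n 1 q p * z q d)).coeff (QShift.of n q d)
      = f d * zCoeff q d := by
  classical
  rw [Finsupp.sum, map_sum]
  simp_rw [toTorus_ofLaurent_mul_z]
  have h1 : ∀ s : Finset (Fin n → ℤ), (∑ x ∈ s, (SkewMonoidAlgebra.single (QShift.of n q x)
      (f x * zCoeff q x) : Torus n q)).coeff (QShift.of n q d)
      = ∑ x ∈ s, if x = d then f x * zCoeff q x else 0 := by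
    intro s
    induction s using Finset.induction with
    | empty => rfl
    | insert a s ha ih =>
      rw [Finset.sum_insert ha, Finset.sum_insert ha, SkewMonoidAlgebra.coeff_add,
        Finsupp.add_apply, ih, SkewMonoidAlgebra.coeff_single_apply]
      simp only [(QShift.of_injective n q).eq_iff]
  rw [h1, Finset.sum_ite_eq']
  split_ifs with hd
  · rfl
  · rw [Finsupp.notMem_support_iff.1 hd, zero_mul]

/-- Distinct `z^d` land in distinct degrees with nonzero coefficients in a domain, so every
coefficient of an expansion can be read off from its image. -/
theorem toTorus_injective : Function.Injective (toTorus (k := k) q n) := by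
  rw [injective_iff_map_eq_zero]
  intro w hw
  obtain ⟨f, rfl⟩ := exists_expansion q w
  have h1 : f = 0 := by
    ext1 d
    have h2 := coeff_toTorus_sum q f d
    rw [hw, SkewMonoidAlgebra.coeff_zero, Finsupp.zero_apply, eq_comm, mul_eq_zero] at h2
    exact h2.resolve_right (zCoeff_ne_zero q d)
  rw [h1, Finsupp.sum_zero_index]

/-- Elements of `A` which are homogeneous in the quantum torus are of the form `p z^d`. -/
theorem eq_ofLaurent_mul_z {w : A k n 1 q} {d : Fin n → ℤ} {r : Laurent k n}
    (hw : toTorus q n w = SkewMonoidAlgebra.single (QShift.of n q d) r) :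
    ∃ p, w = ofLaurent n 1 q p * z q d := by
  classical
  obtain ⟨f, rfl⟩ := exists_expansion q w
  refine ⟨f d, ?_⟩
  have h1 : f = Finsupp.single d (f d) := by
    ext1 d'
    by_cases hd : d' = d
    · rw [hd, Finsupp.single_eq_same]
    · have h2 := coeff_toTorus_sum q f d'
      rw [hw, SkewMonoidAlgebra.coeff_single_apply,
        if_neg fun h3 => hd (QShift.of_injective n q h3).symm, eq_comm, mul_eq_zero] at h2
      rw [Finsupp.single_eq_of_ne hd]
      exact h2.resolve_right (zCoeff_ne_zero q d')
  conv_lhs => rw [h1]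
  rw [Finsupp.sum_single_index (by simp)]

theorem A.noZeroDivisors : NoZeroDivisors (A k n 1 q) :=
  (toTorus_injective q).noZeroDivisors _ (map_zero _) (map_mul _)

theorem ofLaurent_injective : Function.Injective (ofLaurent (k := k) n 1 q) := by
  intro p p' hp
  have h1 := congrArg (toTorus q n) hp
  rw [toTorus_ofLaurent, toTorus_ofLaurent] at h1
  exact SkewMonoidAlgebra.single_injective _ h1

end Expansion

/-! ### Units of `A` and irreducibility of `x_i` -/

section Units

variable {k : Type*} [Field k] (q : kˣ) {n : ℕ}

theorem isUnit_smul_laurent {g : QShift n q} {p : Laurent k n} : IsUnit (g • p) ↔ IsUnit p := by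
  constructor
  · intro hp
    have h1 := hp.map (MulSemiringAction.toRingHom (QShift n q) (Laurent k n) g⁻¹)
    rwa [MulSemiringAction.toRingHom_apply, inv_smul_smul] at h1
  · intro hp
    exact hp.map (MulSemiringAction.toRingHom (QShift n q) (Laurent k n) g)

/-- Evaluation at `h_1 = ⋯ = h_n = 1` kills this element. -/
theorem not_isUnit_lh_sub_one (i : Fin n) : ¬ IsUnit (lh k i 1 - 1) := by
  intro hu
  let f := AddMonoidAlgebra.lift k k (Fin n → ℤ) 1
  have h1 : f (lh k i 1) = 1 := (AddMonoidAlgebra.lift_single _ _ _).trans (one_smul _ _)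
  have h2 := hu.map f
  rw [map_sub f, map_one f, h1, sub_self] at h2
  exact not_isUnit_zero h2

theorem laurent_isUnit_eq_single {p : Laurent k n} (hp : IsUnit p) :
    ∃ m c, c ≠ 0 ∧ p = AddMonoidAlgebra.single m c := by
  obtain ⟨p', hp'⟩ := hp.exists_right_inv
  exact addMonoidAlgebra_unit_eq_single hp'

theorem isUnit_laurent_single (m : Fin n → ℤ) {c : k} (hc : c ≠ 0) :
    IsUnit (AddMonoidAlgebra.single m c : Laurent k n) := by
  refine IsUnit.of_mul_eq_one (AddMonoidAlgebra.single (-m) c⁻¹) ?_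
  rw [AddMonoidAlgebra.single_mul_single, add_neg_cancel, mul_inv_cancel₀ hc]
  rfl

theorem toTorus_x' (i : Fin n) : toTorus q n (x n 1 q i)
    = SkewMonoidAlgebra.single (QShift.of n q (Pi.single i 1)) 1 := toTorus_x q i

theorem toTorus_y' (i : Fin n) : toTorus q n (y n 1 q i)
    = SkewMonoidAlgebra.single (QShift.of n q (-Pi.single i 1)) (lh k i 1 - 1) := toTorus_y q i

theorem toTorus_ofLaurent' (p : Laurent k n) : toTorus q n (ofLaurent n 1 q p)
    = SkewMonoidAlgebra.single (QShift.of n q 0) p := toTorus_ofLaurent q p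

theorem Torus.single_mul_single (d d' : Fin n → ℤ) (p p' : Laurent k n) :
    (SkewMonoidAlgebra.single (QShift.of n q d) p *
      SkewMonoidAlgebra.single (QShift.of n q d') p' : Torus n q)
      = SkewMonoidAlgebra.single (QShift.of n q (d + d')) (p * QShift.of n q d • p') :=
  SkewMonoidAlgebra.single_mul_single

theorem Torus.single_inj {d d' : Fin n → ℤ} {p p' : Laurent k n} (hp : p ≠ 0)
    (h : (SkewMonoidAlgebra.single (QShift.of n q d) p : Torus n q)
      = SkewMonoidAlgebra.single (QShift.of n q d') p') : d = d' ∧ p = p' := by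
  classical
  have h1 := congrArg (fun w : Torus n q => w.coeff (QShift.of n q d)) h
  simp only [SkewMonoidAlgebra.coeff_single_apply, (QShift.of_injective n q).eq_iff,
    if_true] at h1
  by_cases hd : d' = d
  · rw [if_pos hd] at h1
    exact ⟨hd.symm, h1⟩
  · rw [if_neg hd] at h1
    exact absurd h1 hp

/-- The factors of a homogeneous element are homogeneous. -/
theorem homogeneous_of_mul {w w' : A k n 1 q} {e : Fin n → ℤ} {r : Laurent k n} (hr : r ≠ 0)
    (hw : toTorus q n (w * w') = SkewMonoidAlgebra.single (QShift.of n q e) r) :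
    ∃ d d' s s', toTorus q n w = SkewMonoidAlgebra.single (QShift.of n q d) s ∧
      toTorus q n w' = SkewMonoidAlgebra.single (QShift.of n q d') s' ∧ d + d' = e ∧
      s * QShift.of n q d • s' = r := by
  rw [map_mul] at hw
  obtain ⟨a, s, b, t, h1, h2⟩ := skew_eq_single_of_mul_eq_single hr hw
  refine ⟨a.vec, b.vec, s, t, h1, h2, ?_⟩
  rw [h1, h2] at hw
  have h3 := (Torus.single_mul_single q a.vec b.vec s t).symm.trans hw
  obtain ⟨h4, h5⟩ := Torus.single_inj q hr h3.symm
  exact ⟨h4.symm, h5.symm⟩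

/-- An element of negative degree in direction `j` is right divisible by `y_j`, so a shift of the
nonunit `h_j - 1` divides its coefficient. This is what distinguishes `A` from the whole torus,
where every `t_j` is invertible. -/
theorem nonneg_of_isUnit {w : A k n 1 q} {d : Fin n → ℤ} {s : Laurent k n}
    (hw : toTorus q n w = SkewMonoidAlgebra.single (QShift.of n q d) s) (hs : IsUnit s)
    (j : Fin n) : 0 ≤ d j := by
  by_contra! hd
  obtain ⟨p, rfl⟩ := eq_ofLaurent_mul_z q hw
  rw [z_eq_mul_y q hd, ← mul_assoc, map_mul, toTorus_ofLaurent_mul_z, toTorus_y',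
    Torus.single_mul_single] at hw
  obtain ⟨-, h1⟩ := Torus.single_inj q hs.ne_zero hw.symm
  rw [h1] at hs
  exact not_isUnit_lh_sub_one j ((isUnit_smul_laurent q).1 (isUnit_of_mul_isUnit_right hs))

theorem eq_ofLaurent {w : A k n 1 q} {s : Laurent k n}
    (hw : toTorus q n w = SkewMonoidAlgebra.single (QShift.of n q 0) s) :
    w = ofLaurent n 1 q s :=
  toTorus_injective q (hw.trans (toTorus_ofLaurent' q s).symm)

/-- Units of `A` are Laurent monomials. -/
theorem eq_ofLaurent_of_mul_eq_one {w w' : A k n 1 q} (hw : w * w' = 1) :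
    ∃ p, IsUnit p ∧ w = ofLaurent n 1 q p := by
  have h1 : toTorus q n (w * w') = SkewMonoidAlgebra.single (QShift.of n q 0) 1 := by
    rw [hw, map_one]
    rfl
  obtain ⟨d, d', s, s', hd, hd', h2, h3⟩ := homogeneous_of_mul q one_ne_zero h1
  have hs : IsUnit s := IsUnit.of_mul_eq_one _ h3
  have hs' : IsUnit s' := (isUnit_smul_laurent q).1 (IsUnit.of_mul_eq_one _ ((mul_comm _ _).trans h3))
  -- The degrees of a unit and of its inverse are nonnegative and add up to zero.
  have h4 : d = 0 := by
    funext j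
    have h5 := nonneg_of_isUnit q hd hs j
    have h6 := nonneg_of_isUnit q hd' hs' j
    have h7 := congrFun h2 j
    simp only [Pi.add_apply, Pi.zero_apply] at h7 ⊢
    omega
  subst h4
  exact ⟨s, hs, eq_ofLaurent q hd⟩

theorem isUnit_iff {w : A k n 1 q} : IsUnit w ↔ ∃ p, IsUnit p ∧ w = ofLaurent n 1 q p := by
  constructor
  · intro hw
    obtain ⟨w', hw'⟩ := hw.exists_right_inv
    exact eq_ofLaurent_of_mul_eq_one q hw'
  · rintro ⟨p, hp, rfl⟩
    exact hp.map (ofLaurent n 1 q)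

/-- Both factors are homogeneous with unit coefficients, hence of nonnegative degree. The degrees
sum to a basis vector, so one is zero and that factor is a Laurent unit. -/
theorem isUnit_or_isUnit_of_mul_eq_x {i : Fin n} {u v : A k n 1 q} (huv : x n 1 q i = u * v) :
    IsUnit u ∨ IsUnit v := by
  have h1 := toTorus_x' (k := k) q i
  rw [huv] at h1
  obtain ⟨d, d', s, s', hd, hd', h2, h3⟩ := homogeneous_of_mul q one_ne_zero h1
  have hs : IsUnit s := IsUnit.of_mul_eq_one _ h3
  have hs' : IsUnit s' := (isUnit_smul_laurent q).1 (IsUnit.of_mul_eq_one _ ((mul_comm _ _).trans h3))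
  have h5 := nonneg_of_isUnit q hd hs
  have h6 := nonneg_of_isUnit q hd' hs'
  have h7 : ∀ j, j ≠ i → d j = 0 ∧ d' j = 0 := by
    intro j hj
    have h8 := congrFun h2 j
    rw [Pi.single_eq_of_ne hj, Pi.add_apply] at h8
    have := h5 j
    have := h6 j
    omega
  have h8 := congrFun h2 i
  rw [Pi.single_eq_same, Pi.add_apply] at h8
  have h9 := h5 i
  have h10 := h6 i
  rcases (show d i = 0 ∨ d' i = 0 by omega) with h11 | h11
  · left
    have h12 : d = 0 := by
      funext j
      by_cases hj : j = i
      · rw [hj, h11]; rfl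
      · exact (h7 j hj).1
    subst h12
    exact (isUnit_iff q).2 ⟨s, hs, eq_ofLaurent q hd⟩
  · right
    have h12 : d' = 0 := by
      funext j
      by_cases hj : j = i
      · rw [hj, h11]; rfl
      · exact (h7 j hj).2
    subst h12
    exact (isUnit_iff q).2 ⟨s', hs', eq_ofLaurent q hd'⟩

theorem single_ne_zero (j : Fin n) : (Pi.single j 1 : Fin n → ℤ) ≠ 0 := by
  intro h1
  have h2 := congrFun h1 j
  rw [Pi.single_eq_same] at h2
  exact one_ne_zero h2

theorem x_ne_ofLaurent (i : Fin n) (p : Laurent k n) : x n 1 q i ≠ ofLaurent n 1 q p := by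
  intro h1
  have h2 := congrArg (toTorus q n) h1
  rw [toTorus_x', toTorus_ofLaurent'] at h2
  exact single_ne_zero i (Torus.single_inj q one_ne_zero h2).1

theorem y_ne_ofLaurent (i : Fin n) (p : Laurent k n) : y n 1 q i ≠ ofLaurent n 1 q p := by
  intro h1
  have h2 := congrArg (toTorus q n) h1
  rw [toTorus_y', toTorus_ofLaurent'] at h2
  exact single_ne_zero i (neg_eq_zero.1 (Torus.single_inj q (lh_sub_one_ne_zero i) h2).1)

theorem x_mul_y (i : Fin n) :
    x n 1 q i * y n 1 q i = ofLaurent n 1 q (sigma n q i (lh k i 1 - 1)) := by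
  apply toTorus_injective q
  rw [map_mul, toTorus_x, toTorus_y, toTorus_ofLaurent, Torus.x_mul_y]

theorem y_mul_x (i : Fin n) : y n 1 q i * x n 1 q i = h n 1 q i - 1 := by
  apply toTorus_injective q
  rw [map_mul, toTorus_x, toTorus_y, map_sub, map_one, toTorus_h, Torus.y_mul_x, map_sub, map_one]

theorem x_mul_ofLaurent (i : Fin n) (p : Laurent k n) :
    x n 1 q i * ofLaurent n 1 q p = ofLaurent n 1 q (sigma n q i p) * x n 1 q i := by
  apply toTorus_injective q
  rw [map_mul, map_mul, toTorus_x, toTorus_ofLaurent, toTorus_ofLaurent, Torus.x_mul_ofLaurent]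

theorem x_mul_h (i : Fin n) : x n 1 q i * h n 1 q i = (q : k) • (h n 1 q i * x n 1 q i) := by
  rw [← ofLaurent_lh_one, x_mul_ofLaurent, sigma_lh, zpow_one, map_smul, smul_mul_assoc]

theorem isUnit_lh (i : Fin n) (a : ℤ) : IsUnit (lh k i a) := isUnit_laurent_single _ one_ne_zero

theorem isUnit_h (i : Fin n) : IsUnit (h n 1 q i) :=
  (isUnit_iff q).2 ⟨lh k i 1, isUnit_lh i 1, (ofLaurent_lh_one q i).symm⟩

/-! ### Automorphisms preserve the Laurent ring and permute `x_i`, `y_i` up to units -/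

section Aut

variable (ψ : A k n 1 q ≃ₐ[k] A k n 1 q)

/-- The Laurent ring is spanned by units of `A`, and units of `A` are Laurent polynomials. -/
theorem aut_ofLaurent (p : Laurent k n) :
    ∃ p', ψ (ofLaurent n 1 q p) = ofLaurent n 1 q p' := by
  induction p using AddMonoidAlgebra.induction_linear with
  | zero => exact ⟨0, by simp⟩
  | add p p' hp hp' =>
    obtain ⟨r, hr⟩ := hp
    obtain ⟨r', hr'⟩ := hp'
    exact ⟨r + r', by rw [map_add, map_add, hr, hr', map_add]⟩
  | single m c =>
    by_cases hc : c = 0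
    · exact ⟨0, by simp [hc]⟩
    · have h1 : IsUnit (ψ (ofLaurent n 1 q (AddMonoidAlgebra.single m c))) :=
        ((isUnit_laurent_single m hc).map (ofLaurent n 1 q)).map ψ
      obtain ⟨p, -, hp⟩ := (isUnit_iff q).1 h1
      exact ⟨p, hp⟩

theorem aut_x (i : Fin n) : ∃ j, ∃ u : Laurent k n, IsUnit u ∧
    (ψ (x n 1 q i) = ofLaurent n 1 q u * x n 1 q j ∨
      ψ (x n 1 q i) = ofLaurent n 1 q u * y n 1 q j) := by
  -- The element `x_i y_i` is a nonzero Laurent polynomial, so `ψ(x_i)` is a factor of an element of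
  -- degree `0` and is itself homogeneous.
  obtain ⟨r, hr⟩ := aut_ofLaurent q ψ (sigma n q i (lh k i 1 - 1))
  have hr0 : r ≠ 0 := by
    rintro rfl
    rw [map_zero, map_eq_zero_iff ψ ψ.injective,
      map_eq_zero_iff _ (ofLaurent_injective q), map_eq_zero_iff _ (sigma n q i).injective] at hr
    exact lh_sub_one_ne_zero i hr
  rw [← x_mul_y, map_mul] at hr
  have h1 : toTorus q n (ψ (x n 1 q i) * ψ (y n 1 q i))
      = SkewMonoidAlgebra.single (QShift.of n q 0) r := by rw [hr, toTorus_ofLaurent']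
  obtain ⟨d, d', s, s', hd, -, -, -⟩ := homogeneous_of_mul q hr0 h1
  -- In degree `0`, `ψ(x_i)` would be Laurent, and applying `ψ⁻¹` would make `x_i` Laurent.
  have hd0 : d ≠ 0 := by
    rintro rfl
    obtain ⟨p, hp⟩ := aut_ofLaurent q ψ.symm s
    rw [← eq_ofLaurent q hd, AlgEquiv.symm_apply_apply] at hp
    exact x_ne_ofLaurent q i p hp
  obtain ⟨j, hj⟩ := Function.ne_iff.1 hd0
  obtain ⟨p, hp⟩ := eq_ofLaurent_mul_z q hd
  -- A factorization of `ψ(x_i)` pulls back to one of the irreducible `x_i`. If `v` is not Laurent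
  -- it is not a unit, so `w` is.
  have key : ∀ w v : A k n 1 q, ψ (x n 1 q i) = w * v → (∀ p, v ≠ ofLaurent n 1 q p) →
      ∃ u, IsUnit u ∧ ψ (x n 1 q i) = ofLaurent n 1 q u * v := by
    intro w v hwv hv
    have h2 : x n 1 q i = ψ.symm w * ψ.symm v := by
      rw [← map_mul, ← hwv, AlgEquiv.symm_apply_apply]
    rcases isUnit_or_isUnit_of_mul_eq_x q h2 with h3 | h3
    · have h4 := h3.map ψ
      rw [AlgEquiv.apply_symm_apply] at h4
      obtain ⟨u, hu, rfl⟩ := (isUnit_iff q).1 h4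
      exact ⟨u, hu, hwv⟩
    · have h4 := h3.map ψ
      rw [AlgEquiv.apply_symm_apply] at h4
      obtain ⟨u, -, hu⟩ := (isUnit_iff q).1 h4
      exact absurd hu (hv u)
  rcases lt_or_gt_of_ne hj with hj | hj
  · rw [z_eq_mul_y q hj, ← mul_assoc] at hp
    obtain ⟨u, hu, h2⟩ := key _ _ hp (y_ne_ofLaurent q j)
    exact ⟨j, u, hu, Or.inr h2⟩
  · rw [z_eq_mul_x q hj, ← mul_assoc] at hp
    obtain ⟨u, hu, h2⟩ := key _ _ hp (x_ne_ofLaurent q j)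
    exact ⟨j, u, hu, Or.inl h2⟩

theorem tensorCongr_single (g : Fin n → (A₁ k 1 q ≃ₐ[k] A₁ k 1 q)) (i : Fin n) (b : A₁ k 1 q) :
    tensorCongr g (single q i b) = single q i (g i b) := by
  refine (PiTensorProduct.congr_tprod _ _).trans ?_
  rw [single_eq_tprod]
  congr 1
  funext j
  change g j ((Pi.mulSingle i b : Fin n → A₁ k 1 q) j) = _
  by_cases hj : j = i
  · subst hj
    rw [Pi.mulSingle_eq_same, Pi.mulSingle_eq_same]
  · rw [Pi.mulSingle_eq_of_ne hj, Pi.mulSingle_eq_of_ne hj, map_one]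

theorem single_h_inv (i : Fin n) : single q i ↑(A₁.h q)⁻¹ = ofLaurent n 1 q (lh k i (-1)) :=
  (ofLaurent_lh q i (-1)).symm

theorem flip_single_x {g : Fin n → (A₁ k 1 q ≃ₐ[k] A₁ k 1 q)} {i : Fin n} (hg : g i = A₁.flip q) :
    tensorCongr g (x n 1 q i) = ofLaurent n 1 q (-lh k i (-1)) * y n 1 q i := by
  refine (tensorCongr_single q g i (A₁.x q)).trans ?_
  rw [hg, A₁.flip_x, map_neg, map_mul, single_h_inv, map_neg, neg_mul]
  rfl

theorem flip_single_h {g : Fin n → (A₁ k 1 q ≃ₐ[k] A₁ k 1 q)} {i : Fin n} (hg : g i = A₁.flip q) :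
    tensorCongr g (h n 1 q i) = (q : k)⁻¹ • ofLaurent n 1 q (lh k i (-1)) := by
  refine (tensorCongr_single q g i (A₁.h q)).trans ?_
  rw [hg, A₁.flip_h, A₁.coe_hFlip, map_smul, single_h_inv]

/-- The flip sends `x_i` to a unit times `y_i`, so this is `aut_x` for `ψ` composed with the flip.
-/
theorem aut_y (i : Fin n) : ∃ j, ∃ u : Laurent k n, IsUnit u ∧
    (ψ (y n 1 q i) = ofLaurent n 1 q u * x n 1 q j ∨
      ψ (y n 1 q i) = ofLaurent n 1 q u * y n 1 q j) := by
  obtain ⟨j, u, hu, h1⟩ := aut_x q ((tensorCongr fun _ => A₁.flip q).trans ψ) i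
  rw [AlgEquiv.trans_apply, flip_single_x q rfl, map_mul] at h1
  have h2 : IsUnit (ψ (ofLaurent n 1 q (-lh k i (-1)))) :=
    ((isUnit_lh i (-1)).neg.map (ofLaurent n 1 q)).map ψ
  obtain ⟨p, hp, h3⟩ := (isUnit_iff q).1 h2
  obtain ⟨p', hp'⟩ := hp.exists_left_inv
  rw [h3] at h1
  have h4 : ∀ v, ofLaurent n 1 q p * ψ (y n 1 q i) = ofLaurent n 1 q u * v →
      ψ (y n 1 q i) = ofLaurent n 1 q (p' * u) * v := by
    intro v hv
    rw [map_mul, mul_assoc, ← hv, ← mul_assoc, ← map_mul, hp', map_one, one_mul]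
  exact ⟨j, p' * u, (IsUnit.of_mul_eq_one _ hp').mul hu, h1.imp (h4 _) (h4 _)⟩

/-- The right side has exactly the exponents `r + e` and `r`, where `e` is the `j`-th basis vector.
One of them must cancel the constant `-1`, so `r = 0` or `r = -e`, and the scalars follow. -/
theorem laurent_binomial_eq {M r : Fin n → ℤ} {c l a : k} {j : Fin n} (hl : l ≠ 0) (ha : a ≠ 0)
    (heq : (AddMonoidAlgebra.single M c - 1 : Laurent k n)
      = AddMonoidAlgebra.single r l * (a • lh k j 1 - 1)) :
    (M = Pi.single j 1 ∧ c = a) ∨ (M = -Pi.single j 1 ∧ c = a⁻¹) := by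
  classical
  have hj := single_ne_zero j
  set e : Fin n → ℤ := Pi.single j 1 with he
  have h1 : ∀ m, (if M = m then c else 0) - (if 0 = m then 1 else 0)
      = (if r + e = m then l * a else 0) - if r = m then l else 0 := by
    intro m
    rw [mul_sub, lh, AddMonoidAlgebra.smul_single, AddMonoidAlgebra.single_mul_single, mul_one,
      smul_eq_mul, mul_one, ← he, AddMonoidAlgebra.one_def] at heq
    have h2 := congrArg (fun p : Laurent k n => p.coeff m) heq
    simpa only [AddMonoidAlgebra.coeff_sub, AddMonoidAlgebra.coeff_single, Finsupp.sub_apply,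
      Finsupp.single_apply] using h2
  have hre : r + e ≠ r := by simpa using hj
  by_cases hr : r = 0
  · subst hr
    have h2 := h1 e
    have h3 := h1 0
    simp only [zero_add, if_true, if_neg hj, if_neg hj.symm, sub_zero, zero_sub] at h2 h3
    have hM : M = e := by
      by_contra hM
      rw [if_neg hM] at h2
      exact mul_ne_zero hl ha h2.symm
    rw [if_neg (hM ▸ hj)] at h3
    rw [if_pos hM] at h2
    left
    refine ⟨hM, ?_⟩
    rw [h2, show l = 1 by linear_combination h3, one_mul]
  · by_cases hr' : r + e = 0
    · have h2 := h1 r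
      have h3 := h1 0
      simp only [if_true, if_neg hre, if_neg hr, if_neg (Ne.symm hr), hr', sub_zero, zero_sub,
        if_neg (Ne.symm hr)] at h2 h3
      have hM : M = r := by
        by_contra hM
        rw [if_neg hM] at h2
        exact hl (neg_eq_zero.1 h2.symm)
      rw [if_neg (hM ▸ hr)] at h3
      rw [if_pos hM] at h2
      right
      refine ⟨hM.trans (eq_neg_of_add_eq_zero_left hr'), ?_⟩
      rw [h2]
      field_simp
      linear_combination h3
    -- With neither exponent zero, `r` and `r + e` would both have to equal `M`.
    · have h2 := h1 r
      have h3 := h1 (r + e)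
      simp only [if_true, if_neg hre, if_neg hre.symm, if_neg (Ne.symm hr), if_neg (Ne.symm hr'),
        sub_zero, zero_sub] at h2 h3
      have hM : M = r := by
        by_contra hM
        rw [if_neg hM] at h2
        exact hl (neg_eq_zero.1 h2.symm)
      rw [if_neg (hM ▸ hre.symm)] at h3
      exact absurd h3.symm (mul_ne_zero hl ha)

end Aut

end Units

/-! ### Images of the generators under an automorphism -/

section Tame

variable {k : Type*} [Field k] (q : kˣ) {n : ℕ} (ψ : A k n 1 q ≃ₐ[k] A k n 1 q)

theorem aut_h (i : Fin n) : ∃ M c, c ≠ 0 ∧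
    ψ (h n 1 q i) = ofLaurent n 1 q (AddMonoidAlgebra.single M c) := by
  obtain ⟨p, hp, h1⟩ := (isUnit_iff q).1 ((isUnit_h q i).map ψ)
  obtain ⟨M, c, hc, rfl⟩ := laurent_isUnit_eq_single hp
  exact ⟨M, c, hc, h1⟩

theorem of_smul_single (j : Fin n) (b : ℤ) (M : Fin n → ℤ) (c : k) :
    QShift.of n q (Pi.single j b) • (AddMonoidAlgebra.single M c : Laurent k n)
      = AddMonoidAlgebra.single M (c * ((q ^ (b * M j) : kˣ) : k)) := by
  rw [QShift.smul_single]
  simp [QShift.vec, QShift.of, Pi.single_apply]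

/-- An element `u t_j^b` of the quantum torus, with `u` a nonzero polynomial, which `q`-commutes
with a monomial. -/
theorem zpow_eq_of_commutation {j : Fin n} {b : ℤ} {u : Laurent k n} (hu : u ≠ 0)
    {M : Fin n → ℤ} {c : k} (hc : c ≠ 0)
    (hcomm : (SkewMonoidAlgebra.single (QShift.of n q (Pi.single j b)) u *
        SkewMonoidAlgebra.single (QShift.of n q 0) (AddMonoidAlgebra.single M c) : Torus n q)
      = (q : k) • (SkewMonoidAlgebra.single (QShift.of n q 0) (AddMonoidAlgebra.single M c) *
        SkewMonoidAlgebra.single (QShift.of n q (Pi.single j b)) u)) :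
    q ^ (b * M j) = q := by
  rw [Torus.single_mul_single, Torus.single_mul_single, of_smul_single, QShift.of_zero, one_smul,
    SkewMonoidAlgebra.smul_single, zero_add, add_zero] at hcomm
  have h1 := SkewMonoidAlgebra.single_injective _ hcomm
  rw [mul_comm, ← smul_mul_assoc, AddMonoidAlgebra.smul_single, smul_eq_mul] at h1
  -- Both products are the common factor `u` times a scalar multiple of the same monomial;
  -- cancelling `u` leaves an equation of scalars.
  have h2 := congrArg (fun p : Laurent k n => p.coeff M) (mul_right_cancel₀ hu h1)
  simp only [AddMonoidAlgebra.coeff_single, Finsupp.single_eq_same] at h2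
  rw [mul_comm] at h2
  exact Units.ext (mul_right_cancel₀ hc h2)

theorem inv_ne_self {q : kˣ} (hq : (q : k) ^ 2 ≠ 1) : q⁻¹ ≠ q := fun h1 => hq (by
  rw [pow_two, ← Units.val_mul]
  nth_rw 1 [← h1]
  rw [inv_mul_cancel, Units.val_one])

variable {q}

/-- The product `ψ(y_i)ψ(x_i) = ψ(h_i) - 1` has degree `0`, so one factor is of type `x` and the
other of type `y`, with the same index. Comparing binomials determines `ψ(h_i)` up to two
candidates, and `ψ(x_i)ψ(h_i) = qψ(h_i)ψ(x_i)` decides between them. -/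
theorem aut_generators (hq : (q : k) ^ 2 ≠ 1) (i : Fin n) : ∃ j, ∃ u : Laurent k n, IsUnit u ∧
    ((ψ (h n 1 q i) = h n 1 q j ∧ ψ (x n 1 q i) = ofLaurent n 1 q u * x n 1 q j) ∨
      (ψ (h n 1 q i) = (q : k)⁻¹ • ofLaurent n 1 q (lh k j (-1)) ∧
        ψ (x n 1 q i) = ofLaurent n 1 q u * y n 1 q j)) := by
  obtain ⟨j, u, hu, hx⟩ := aut_x q ψ i
  obtain ⟨l, v, hv, hy⟩ := aut_y q ψ i
  obtain ⟨M, c, hc, hh⟩ := aut_h q ψ i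
  have hL : lh k j 1 - 1 ≠ 0 := lh_sub_one_ne_zero j
  have hyx : toTorus q n (ψ (y n 1 q i)) * toTorus q n (ψ (x n 1 q i))
      = SkewMonoidAlgebra.single (QShift.of n q 0) (AddMonoidAlgebra.single M c - 1) := by
    rw [← map_mul, ← map_mul, y_mul_x, ← toTorus_ofLaurent']
    simp only [map_sub, map_one, hh]
  have hxh : toTorus q n (ψ (x n 1 q i)) *
        SkewMonoidAlgebra.single (QShift.of n q 0) (AddMonoidAlgebra.single M c)
      = (q : k) • (SkewMonoidAlgebra.single (QShift.of n q 0) (AddMonoidAlgebra.single M c) *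
        toTorus q n (ψ (x n 1 q i))) := by
    rw [← toTorus_ofLaurent', ← hh, ← map_mul, ← map_mul, ← map_mul, ← map_mul, x_mul_h, map_smul,
      map_smul]
  have hsm : ∀ {g : QShift n q} {p : Laurent k n}, p ≠ 0 → g • p ≠ 0 :=
    fun hp h0 => hp ((smul_eq_zero_iff_eq _).1 h0)
  have toX : ∀ j (u : Laurent k n), toTorus q n (ofLaurent n 1 q u * x n 1 q j)
      = SkewMonoidAlgebra.single (QShift.of n q (Pi.single j 1)) u := by
    intro j u
    rw [map_mul, toTorus_ofLaurent', toTorus_x', Torus.single_mul_single, zero_add, smul_one,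
      mul_one]
  have toY : ∀ j (u : Laurent k n), toTorus q n (ofLaurent n 1 q u * y n 1 q j)
      = SkewMonoidAlgebra.single (QShift.of n q (Pi.single j (-1))) (u * (lh k j 1 - 1)) := by
    intro j u
    rw [map_mul, toTorus_ofLaurent', toTorus_y', Torus.single_mul_single, zero_add,
      QShift.of_zero, one_smul, Pi.single_neg]
  have degree : ∀ {a b : ℤ}, b ≠ 0 → Pi.single l a + Pi.single j b = (0 : Fin n → ℤ) →
      l = j ∧ a + b = 0 := by
    intro a b hb h1
    have h2 := congrFun h1 j
    rw [Pi.add_apply, Pi.single_eq_same, Pi.zero_apply] at h2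
    by_cases hl : j = l
    · rw [hl, Pi.single_eq_same] at h2
      exact ⟨hl.symm, h2⟩
    · rw [Pi.single_eq_of_ne hl, zero_add] at h2
      exact absurd h2 hb
  refine ⟨j, u, hu, ?_⟩
  rcases hx with hx | hx <;> rcases hy with hy | hy
  -- Two factors of type `x` have total degree a sum of two basis vectors, which is not zero.
  · rw [hx, hy, toX, toX, Torus.single_mul_single] at hyx
    have h1 := degree one_ne_zero
      (Torus.single_inj q (mul_ne_zero hv.ne_zero (hsm hu.ne_zero)) hyx).1
    omega
  · rw [hx, hy, toX, toY, Torus.single_mul_single] at hyx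
    obtain ⟨h1, h2⟩ := Torus.single_inj q (mul_ne_zero (mul_ne_zero hv.ne_zero
      (lh_sub_one_ne_zero l)) (hsm hu.ne_zero)) hyx
    obtain ⟨rfl, -⟩ := degree one_ne_zero h1
    obtain ⟨r, a, ha, h3⟩ := laurent_isUnit_eq_single
      (hv.mul ((isUnit_smul_laurent q (g := QShift.of n q (Pi.single l (-1)))).2 hu))
    rw [mul_right_comm, h3, ← one_smul k (lh k l 1)] at h2
    rw [hx, toX] at hxh
    have h4 := zpow_eq_of_commutation q hu.ne_zero hc hxh
    left
    refine ⟨?_, hx⟩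
    -- If `ψ(h_i)` were `h_l⁻¹`, then `ψ(x_i)` would commute with it up to `q⁻¹` instead of `q`.
    rcases laurent_binomial_eq ha one_ne_zero h2.symm with ⟨rfl, rfl⟩ | ⟨rfl, -⟩
    · exact hh.trans (ofLaurent_lh_one q l)
    · rw [Pi.neg_apply, Pi.single_eq_same, one_mul, zpow_neg_one] at h4
      exact absurd h4 (inv_ne_self hq)
  · rw [hx, hy, toX, toY, Torus.single_mul_single] at hyx
    obtain ⟨h1, h2⟩ := Torus.single_inj q (mul_ne_zero hv.ne_zero
      (hsm (mul_ne_zero hu.ne_zero hL))) hyx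
    obtain ⟨rfl, -⟩ := degree (by norm_num) h1
    obtain ⟨r, a, ha, h3⟩ := laurent_isUnit_eq_single
      (hv.mul ((isUnit_smul_laurent q (g := QShift.of n q (Pi.single l 1))).2 hu))
    -- The coefficient `h_l - 1` of `y_l` passes `x_l` and becomes `q h_l - 1`; this is the source
    -- of the scalar `q⁻¹` in `ψ(h_i)`.
    rw [smul_mul', ← mul_assoc, h3, smul_sub, smul_one, ← sigma_eq_smul, sigma_lh, zpow_one] at h2
    rw [hx, toY] at hxh
    have h4 := zpow_eq_of_commutation q (mul_ne_zero hu.ne_zero hL) hc hxh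
    right
    refine ⟨?_, hx⟩
    rcases laurent_binomial_eq ha q.ne_zero h2.symm with ⟨rfl, -⟩ | ⟨rfl, rfl⟩
    · rw [Pi.single_eq_same, mul_one, zpow_neg_one] at h4
      exact absurd h4 (inv_ne_self hq)
    · rw [hh, ← map_smul, lh, AddMonoidAlgebra.smul_single, smul_eq_mul, mul_one, Pi.single_neg]
  · rw [hx, hy, toY, toY, Torus.single_mul_single] at hyx
    have h1 := degree (by norm_num) (Torus.single_inj q (mul_ne_zero (mul_ne_zero hv.ne_zero
      (lh_sub_one_ne_zero l)) (hsm (mul_ne_zero hu.ne_zero hL))) hyx).1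
    omega

/-! ### Tensor products of automorphisms and permutations of the factors -/

theorem tensorCongr_mul (g g' : Fin n → (A₁ k 1 q ≃ₐ[k] A₁ k 1 q)) :
    tensorCongr (g * g') = tensorCongr g * tensorCongr g' := by
  have h1 : ((tensorCongr (g * g') : A k n 1 q ≃ₐ[k] A k n 1 q) : A k n 1 q →ₐ[k] A k n 1 q)
      = ((tensorCongr g * tensorCongr g' : A k n 1 q ≃ₐ[k] A k n 1 q) :
        A k n 1 q →ₐ[k] A k n 1 q) := by
    refine PiTensorProduct.algHom_ext fun i => AlgHom.ext fun b => ?_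
    change tensorCongr (g * g') (single q i b) = tensorCongr g (tensorCongr g' (single q i b))
    rw [tensorCongr_single, tensorCongr_single, tensorCongr_single]
    rfl
  exact AlgEquiv.ext fun w => DFunLike.congr_fun h1 w

theorem tensorCongr_one :
    tensorCongr (1 : Fin n → (A₁ k 1 q ≃ₐ[k] A₁ k 1 q)) = 1 := by
  have h1 := tensorCongr_mul (1 : Fin n → (A₁ k 1 q ≃ₐ[k] A₁ k 1 q)) 1
  rwa [mul_one, eq_comm, mul_eq_left] at h1

variable (q n) in
/-- The tensor product of automorphisms as a homomorphism of groups. -/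
def tensorHom : (Fin n → (A₁ k 1 q ≃ₐ[k] A₁ k 1 q)) →* (A k n 1 q ≃ₐ[k] A k n 1 q) where
  toFun := tensorCongr
  map_one' := tensorCongr_one
  map_mul' := tensorCongr_mul

variable (q) in
/-- The automorphism that permutes the tensor factors. -/
def permEquiv (w : Equiv.Perm (Fin n)) : A k n 1 q ≃ₐ[k] A k n 1 q :=
  AlgEquiv.ofLinearEquiv (PiTensorProduct.reindex k (fun _ : Fin n => A₁ k 1 q) w)
    (by
      rw [PiTensorProduct.one_def]
      exact PiTensorProduct.reindex_tprod _ _)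
    (by
      refine (LinearMap.map_mul_iff
        (PiTensorProduct.reindex k (fun _ : Fin n => A₁ k 1 q) w).toLinearMap).2 ?_
      ext b b'
      change PiTensorProduct.reindex k (fun _ : Fin n => A₁ k 1 q) w
          (PiTensorProduct.tprod k b * PiTensorProduct.tprod k b')
        = PiTensorProduct.reindex k (fun _ : Fin n => A₁ k 1 q) w (PiTensorProduct.tprod k b) *
          PiTensorProduct.reindex k (fun _ : Fin n => A₁ k 1 q) w (PiTensorProduct.tprod k b')
      rw [PiTensorProduct.tprod_mul_tprod, PiTensorProduct.reindex_tprod,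
        PiTensorProduct.reindex_tprod, PiTensorProduct.reindex_tprod,
        PiTensorProduct.tprod_mul_tprod]
      rfl)

theorem permEquiv_single (w : Equiv.Perm (Fin n)) (i : Fin n) (b : A₁ k 1 q) :
    permEquiv q w (single q i b) = single q (w i) b := by
  refine (PiTensorProduct.reindex_tprod (R := k) (s := fun _ => A₁ k 1 q) w _).trans ?_
  rw [single_eq_tprod]
  congr 1
  funext j
  change (Pi.mulSingle i b : Fin n → A₁ k 1 q) (w.symm j) = _
  by_cases hj : j = w i
  · subst hj
    rw [Equiv.symm_apply_apply, Pi.mulSingle_eq_same, Pi.mulSingle_eq_same]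
  · rw [Pi.mulSingle_eq_of_ne hj, Pi.mulSingle_eq_of_ne]
    rintro rfl
    exact hj (w.apply_symm_apply j).symm

variable [NeZero n]

theorem permEquiv_mem (w : Equiv.Perm (Fin n)) : permEquiv q w ∈ qwaTame n 1 q :=
  Subgroup.subset_closure (Or.inl (Or.inr ⟨w, fun i =>
    ⟨permEquiv_single w i _, permEquiv_single w i _, permEquiv_single w i _⟩⟩))

/-- Acting by `g` in slot `i` is the conjugate of `φ_g` by the transposition of `0` and `i`. -/
theorem tensorCongr_mulSingle_mem (i : Fin n) (g : A₁ k 1 q ≃ₐ[k] A₁ k 1 q) :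
    tensorHom q n (Pi.mulSingle i g) ∈ qwaTame n 1 q := by
  have h1 : ((tensorHom q n (Pi.mulSingle i g) : A k n 1 q ≃ₐ[k] A k n 1 q) :
        A k n 1 q →ₐ[k] A k n 1 q)
      = ((permEquiv q (Equiv.swap 0 i) * (phi n 1 q g * permEquiv q (Equiv.swap 0 i)) :
        A k n 1 q ≃ₐ[k] A k n 1 q) : A k n 1 q →ₐ[k] A k n 1 q) := by
    refine PiTensorProduct.algHom_ext fun j => AlgHom.ext fun b => ?_
    change tensorCongr _ (single q j b)
      = permEquiv q _ (tensorCongr _ (permEquiv q _ (single q j b)))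
    rw [tensorCongr_single, permEquiv_single, tensorCongr_single, permEquiv_single,
      Equiv.swap_apply_self]
    congr 1
    by_cases hj : j = i
    · subst hj
      rw [Pi.mulSingle_eq_same, if_pos (Equiv.swap_apply_right _ _)]
    · rw [Pi.mulSingle_eq_of_ne hj, if_neg]
      · rfl
      · intro h0
        rw [Equiv.swap_apply_eq_iff, Equiv.swap_apply_left] at h0
        exact hj h0
  have h2 : tensorHom q n (Pi.mulSingle i g)
      = permEquiv q (Equiv.swap 0 i) * (phi n 1 q g * permEquiv q (Equiv.swap 0 i)) :=
    AlgEquiv.ext fun w => DFunLike.congr_fun h1 w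
  rw [h2]
  exact mul_mem (permEquiv_mem _) (mul_mem
    (Subgroup.subset_closure (Or.inl (Or.inl ⟨g, rfl⟩))) (permEquiv_mem _))

theorem tensorCongr_mem (g : Fin n → (A₁ k 1 q ≃ₐ[k] A₁ k 1 q)) :
    tensorCongr g ∈ qwaTame n 1 q :=
  Subgroup.pi_mem_of_mulSingle_mem (H := (qwaTame n 1 q).comap (tensorHom q n)) g
    fun i => tensorCongr_mulSingle_mem i (g i)

/-! ### Every automorphism is tame -/

theorem h_injective : Function.Injective (h (k := k) n 1 q) := by
  intro i j hij
  rw [← ofLaurent_lh_one, ← ofLaurent_lh_one] at hij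
  have h1 := congrArg (fun p : Laurent k n => p.coeff (Pi.single i 1)) (ofLaurent_injective q hij)
  by_contra hne
  simp only [lh, AddMonoidAlgebra.coeff_single, Finsupp.single_eq_same] at h1
  rw [Finsupp.single_eq_of_ne] at h1
  · exact one_ne_zero h1
  · intro h2
    have h3 := congrFun h2 i
    rw [Pi.single_eq_same, Pi.single_eq_of_ne hne] at h3
    exact one_ne_zero h3

theorem h_ne_smul_lh (i j : Fin n) (c : k) (a : ℤ) (ha : a < 0) :
    h n 1 q i ≠ c • ofLaurent n 1 q (lh k j a) := by
  intro hij
  rw [← ofLaurent_lh_one, ← map_smul] at hij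
  have h1 := congrArg (fun p : Laurent k n => p.coeff (Pi.single i 1)) (ofLaurent_injective q hij)
  simp only [lh, AddMonoidAlgebra.smul_single, AddMonoidAlgebra.coeff_single,
    Finsupp.single_eq_same] at h1
  rw [Finsupp.single_eq_of_ne] at h1
  · exact one_ne_zero h1
  · intro h2
    have h3 := congrFun h2 i
    rw [Pi.single_eq_same] at h3
    by_cases hne : i = j
    · rw [hne, Pi.single_eq_same] at h3
      omega
    · rw [Pi.single_eq_of_ne hne] at h3
      exact one_ne_zero h3

/-- Fixing every `h_i` forces `ψ(x_i) = u_i x_i` with the same index. The compatibility of `u`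
expresses that `ψ(x_i)` and `ψ(x_l)` commute, and `ψ(y_i)` is found by cancelling `x_i` in the image
of `y_i x_i = h_i - 1`. -/
theorem mem_of_fix_h (hq : (q : k) ^ 2 ≠ 1) (hψ : ∀ i, ψ (h n 1 q i) = h n 1 q i) :
    ψ ∈ qwaTame n 1 q := by
  have key : ∀ i, ∃ u : Laurent k n, IsUnit u ∧
      ψ (x n 1 q i) = ofLaurent n 1 q u * x n 1 q i := by
    intro i
    obtain ⟨j, u, hu, h1 | h1⟩ := aut_generators ψ hq i
    · rw [hψ] at h1
      have h2 := h_injective h1.1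
      subst h2
      exact ⟨u, hu, h1.2⟩
    · rw [hψ] at h1
      exact absurd h1.1 (h_ne_smul_lh _ _ _ _ (by norm_num))
  choose u hu hx using key
  refine Subgroup.subset_closure (Or.inr ⟨fun i => ((hu i).map (ofLaurent n 1 q)).unit,
    ⟨u, fun i => rfl, ?_⟩, ?_⟩)
  · intro i l hl
    have h1 : ψ (x n 1 q i) * ψ (x n 1 q l) = ψ (x n 1 q l) * ψ (x n 1 q i) := by
      rw [← map_mul, ← map_mul]
      congr 1
      apply toTorus_injective q
      rw [map_mul, map_mul, toTorus_x', toTorus_x', Torus.single_mul_single,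
        Torus.single_mul_single, smul_one, smul_one, add_comm]
    have h2 := congrArg (toTorus q n) h1
    simp only [hx, map_mul, toTorus_ofLaurent', toTorus_x', Torus.single_mul_single, smul_one,
      mul_one, zero_add] at h2
    rw [sigma_eq_smul, sigma_eq_smul]
    exact (Torus.single_inj q (mul_ne_zero (hu i).ne_zero
      fun h0 => (hu l).ne_zero ((smul_eq_zero_iff_eq _).1 h0)) h2).2
  · intro i
    refine ⟨hψ i, hx i, ?_⟩
    have h1 : ψ (y n 1 q i) * ψ (x n 1 q i) = y n 1 q i * x n 1 q i := by
      rw [← map_mul, y_mul_x, map_sub, map_one, hψ]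
    rw [hx, ← mul_assoc] at h1
    have := A.noZeroDivisors (k := k) q (n := n)
    have hx0 : x n 1 q i ≠ 0 := fun h0 =>
      x_ne_ofLaurent q i 0 (h0.trans (map_zero (ofLaurent n 1 q)).symm)
    rw [Units.eq_mul_inv_iff_mul_eq]
    exact mul_right_cancel₀ hx0 h1

/-- Injectivity of `ψ` makes `w` a permutation, and undoing it on the factors reduces to
`mem_of_fix_h`. -/
theorem mem_of_map_h (hq : (q : k) ^ 2 ≠ 1) (w : Fin n → Fin n)
    (hψ : ∀ i, ψ (h n 1 q i) = h n 1 q (w i)) : ψ ∈ qwaTame n 1 q := by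
  have hw : Function.Injective w := by
    intro i j hij
    apply h_injective (k := k) (q := q)
    apply ψ.injective
    rw [hψ, hψ, hij]
  let w' : Equiv.Perm (Fin n) := Equiv.ofBijective w (Finite.injective_iff_bijective.1 hw)
  have h1 : (permEquiv q w')⁻¹ * ψ ∈ qwaTame n 1 q := by
    refine mem_of_fix_h _ hq fun i => ?_
    change (permEquiv q w').symm (ψ _) = _
    rw [AlgEquiv.symm_apply_eq, hψ]
    exact (permEquiv_single w' i _).symm
  exact (Subgroup.mul_mem_cancel_left _ (inv_mem (permEquiv_mem w'))).1 h1

/-- Every automorphism of a tensor power of `A(1, q)` is qwa-tame. -/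
theorem mem_qwaTame (hq : (q : k) ^ 2 ≠ 1) : ψ ∈ qwaTame n 1 q := by
  classical
  choose w u hu hψ using aut_generators ψ hq
  -- Flip exactly the slots where `ψ` inverts `h_i`. The map `h ↦ q⁻¹h⁻¹` is an involution on powers
  -- of `h` up to scalars, so `ψ` after `g` sends each `h_i` to `h_{w(i)}`.
  let g : Fin n → (A₁ k 1 q ≃ₐ[k] A₁ k 1 q) := fun i =>
    if ψ (h n 1 q i) = h n 1 q (w i) then 1 else A₁.flip q
  have h1 : ψ * tensorCongr g ∈ qwaTame n 1 q := by
    refine mem_of_map_h _ hq w fun i => ?_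
    change ψ (tensorCongr g _) = _
    by_cases hi : ψ (h n 1 q i) = h n 1 q (w i)
    · have h2 : tensorCongr g (h n 1 q i) = h n 1 q i := by
        refine (tensorCongr_single q g i _).trans ?_
        have hg : g i = 1 := if_pos hi
        rw [hg]
        rfl
      rw [h2, hi]
    · have hg : g i = A₁.flip q := if_neg hi
      rw [flip_single_h q hg, map_smul]
      have h3 := ((hψ i).resolve_left fun h0 => hi h0.1).1
      have h4 : h n 1 q i * ofLaurent n 1 q (lh k i (-1)) = 1 := by
        rw [← ofLaurent_lh_one, ← map_mul, lh_mul_lh_neg, map_one]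
      have h5 : h n 1 q (w i) * ofLaurent n 1 q (lh k (w i) (-1)) = 1 := by
        rw [← ofLaurent_lh_one, ← map_mul, lh_mul_lh_neg, map_one]
      have h6 := congrArg ψ h4
      rw [map_mul, map_one, h3] at h6
      calc (q : k)⁻¹ • ψ (ofLaurent n 1 q (lh k i (-1)))
          = h n 1 q (w i) * (((q : k)⁻¹ • ofLaurent n 1 q (lh k (w i) (-1))) *
              ψ (ofLaurent n 1 q (lh k i (-1)))) := by
            rw [smul_mul_assoc, mul_smul_comm, ← mul_assoc, h5, one_mul]
        _ = h n 1 q (w i) := by rw [h6, mul_one]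
  exact (Subgroup.mul_mem_cancel_right _ (tensorCongr_mem g)).1 h1

end Tame

end QWeyl

end

theorem theorem1p1 {k : Type*} [Field k] (n : ℕ) [NeZero n] (α q : kˣ) (hq : (q : k) ^ 2 ≠ 1) :
    Nonempty (QWeyl.AAlg k α q ≃ₐ[k] QWeyl.A₁ k 1 q) ∧
    ∀ (e : QWeyl.AAlg k α q ≃ₐ[k] QWeyl.A₁ k 1 q)
      (ψ : (⨂[k] _ : Fin n, QWeyl.AAlg k α q) ≃ₐ[k] (⨂[k] _ : Fin n, QWeyl.AAlg k α q)),
      AlgEquiv.autCongr (QWeyl.tensorCongr fun _ : Fin n => e) ψ ∈ QWeyl.qwaTame n 1 q :=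
  -- Conjugation by `e^{⊗n}` yields an automorphism of `A`, and all of these are tame.
  ⟨⟨QWeyl.AAlg.equivA₁ α q hq⟩, fun _ _ => QWeyl.mem_qwaTame _ hq⟩
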